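/- **Proposition 2.8.** Let $M$ be a smooth (Hausdorff) manifold without boundary, of dimension $m\ge 1$, and let $\mathscr F$ be a (finite or infinite) family of smooth vector fields on $M$ that is bracket-generating: for every $p\in M$, the values at $p$ of the vector fields in the real Lie algebra generated by $\mathscr F$ fill $T_pM$. Then $\mathscr F$ is *essentially non-holonomic*, that is: for every $T>0$ and every $o\in M$ there are $X_1,\dots,X_m\in\mathscr F$, a vector $\hat t\in\mathbb R^m$ with $|\hat t|_1=\sum_i|\hat t_i|<T$, and an open neighborhood $\Omega$ of $\hat t$ contained in $\{t\in\mathbb R^m:|t|_1<T\}$, such that the map $$\phi(t_1,\dots,t_m)=\Phi^{t_m}_{X_m}\circ\dots\circ\Phi^{t_1}_{X_1}(o)$$ is defined and continuous on $\Omega$ and $\phi:\Omega\to M$ is essentially open at $\hat t$ at some scale $U\subseteq\Omega$. Here $\Phi_X^t(p)$ is the value at time $t$ of the integral curve of $X$ starting at $p$ (times may be negative). A continuous map $f:P\to N$ between topological manifolds of the same dimension $k\ge1$ is *essentially open at $p\in P$ at scale $U$* if: $U$ is a neighborhood of $p$ homeomorphic to the open Euclidean ball of dimension $k$, with $\partial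 U$ homeomorphic to $\mathbb S^{k-1}$; and there is a neighborhood $V$ of $f(p)$ homeomorphic to the open Euclidean ball of dimension $k$ such that $f(\partial U)\subseteq V\setminus\{f(p)\}$ and the induced homomorphism $$f_*:\widetilde H_{k-1}(\partial U;\mathbb Z)\to \widetilde H_{k-1}(V\setminus\{f(p)\};\mathbb Z)$$ on reduced singular homology is not constant (i.e. not zero). For $k\ge 2$, reduced and ordinary homology agree in degree $k-1$. -/

import Mathlib

open Set Topology
open scoped Manifold ContDiff

/-! ### Reduced singular homology -/

section Homology

universe u v

open CategoryTheory

/-- The `n`-th singular homology group of `X` with integer coefficients. -/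
noncomputable abbrev singularH (n : ℕ) (X : TopCat.{u}) : ModuleCat.{u} ℤ :=
  ((AlgebraicTopology.singularHomologyFunctor (ModuleCat.{u} ℤ) n).obj
    (ModuleCat.of ℤ (ULift.{u} ℤ))).obj X

/-- The homomorphism induced by a continuous map on singular homology. -/
noncomputable def singularHMap (n : ℕ) {X Y : TopCat.{u}} (f : X ⟶ Y) :
    singularH n X →ₗ[ℤ] singularH n Y :=
  (((AlgebraicTopology.singularHomologyFunctor (ModuleCat.{u} ℤ) n).obj
    (ModuleCat.of ℤ (ULift.{u} ℤ))).map f).hom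

/-- The map from a space to the one-point space. -/
def toPoint (X : TopCat.{u}) : X ⟶ TopCat.of PUnit.{u + 1} :=
  TopCat.ofHom (ContinuousMap.const X PUnit.unit)

/-- Reduced singular homology (of a nonempty space): the kernel of the homomorphism
`H_n(X) → H_n(pt)`. For `n ≥ 1` this is all of `H_n(X)`; for `n = 0` it makes
`H_0` of a two-point space isomorphic to `ℤ`, as for higher dimensional spheres. -/
noncomputable def reducedH (n : ℕ) (X : TopCat.{u}) : Submodule ℤ (singularH n X) :=
  LinearMap.ker (singularHMap n (toPoint X))

theorem singularHMap_mem_reducedH (n : ℕ) {X Y : TopCat.{u}} (f : X ⟶ Y) (a : singularH n X)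
    (ha : a ∈ reducedH n X) : singularHMap n f a ∈ reducedH n Y := by
  have h : f ≫ toPoint Y = toPoint X := rfl
  have h2 : singularHMap n (toPoint Y) (singularHMap n f a) = singularHMap n (toPoint X) a := by
    rw [← h]
    simp [singularHMap]
  exact LinearMap.mem_ker.2 (h2.trans (LinearMap.mem_ker.1 ha))

/-- The homomorphism `f_*` induced by a continuous map on reduced singular homology. -/
noncomputable def reducedHMap (n : ℕ) {X Y : TopCat.{u}} (f : X ⟶ Y) :
    reducedH n X →ₗ[ℤ] reducedH n Y :=
  (singularHMap n f).restrict (singularHMap_mem_reducedH n f)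

/-- A continuous map between spaces that may live in different universes, seen as a morphism
of topological spaces in a common universe. -/
def liftedHom {X : Type u} {Y : Type v} [TopologicalSpace X] [TopologicalSpace Y] (f : C(X, Y)) :
    TopCat.of (ULift.{v} X) ⟶ TopCat.of (ULift.{u} Y) :=
  TopCat.ofHom ⟨fun x => ULift.up (f x.down),
    continuous_uliftUp.comp (f.continuous.comp continuous_uliftDown)⟩

/-- The homomorphism induced by `f` on the `n`-th reduced integral singular homology groups is
not constant. -/
def InducesNonconstant (n : ℕ) {X : Type u} {Y : Type v} [TopologicalSpace X]
    [TopologicalSpace Y] (f : C(X, Y)) : Prop :=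
  ∃ a b, reducedHMap n (liftedHom f) a ≠ reducedHMap n (liftedHom f) b

end Homology

/-! ### Essentially open maps -/

/-- A continuous map `f : X → Y` between topological manifolds of the same dimension `k ≥ 1` is
essentially open at `p` at scale `U`. -/
def EssentiallyOpenAt (k : ℕ) {X Y : Type*} [TopologicalSpace X] [TopologicalSpace Y]
    (f : C(X, Y)) (p : X) (U : Set X) : Prop :=
  U ∈ 𝓝 p ∧
  Nonempty (U ≃ₜ Metric.ball (0 : EuclideanSpace ℝ (Fin k)) 1) ∧
  Nonempty (frontier U ≃ₜ Metric.sphere (0 : EuclideanSpace ℝ (Fin k)) 1) ∧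
  ∃ V : Set Y, V ∈ 𝓝 (f p) ∧
    Nonempty (V ≃ₜ Metric.ball (0 : EuclideanSpace ℝ (Fin k)) 1) ∧
    ∃ h : MapsTo f (frontier U) (V \ {f p}),
      InducesNonconstant (k - 1)
        (⟨h.restrict f (frontier U) (V \ {f p}),
          f.continuous.continuousOn.mapsToRestrict h⟩ : C(frontier U, ↥(V \ {f p})))

/-! ### Vector fields, flows and bracket-generating families -/

section VectorFields

variable {m : ℕ} {M : Type*} [TopologicalSpace M] [ChartedSpace (EuclideanSpace ℝ (Fin m)) M]

/-- A smooth vector field on `M`. -/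
def IsSmoothVectorField [IsManifold (𝓡 m) ∞ M] (X : (x : M) → TangentSpace (𝓡 m) x) : Prop :=
  ContMDiff (𝓡 m) (𝓡 m).tangent ∞ (fun x => (⟨x, X x⟩ : TangentBundle (𝓡 m) M))

/-- Membership in the Lie algebra of vector fields generated by the family `F`: the smallest
real vector space of vector fields containing `F` and closed under Lie brackets. -/
inductive InLieAlgebraGeneratedBy (F : Set ((x : M) → TangentSpace (𝓡 m) x)) :
    ((x : M) → TangentSpace (𝓡 m) x) → Prop
  | of (X : (x : M) → TangentSpace (𝓡 m) x) (hX : X ∈ F) : InLieAlgebraGeneratedBy F X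
  | zero : InLieAlgebraGeneratedBy F 0
  | add (X Y : (x : M) → TangentSpace (𝓡 m) x) (hX : InLieAlgebraGeneratedBy F X)
      (hY : InLieAlgebraGeneratedBy F Y) : InLieAlgebraGeneratedBy F (X + Y)
  | smul (c : ℝ) (X : (x : M) → TangentSpace (𝓡 m) x) (hX : InLieAlgebraGeneratedBy F X) :
      InLieAlgebraGeneratedBy F (c • X)
  | bracket (X Y : (x : M) → TangentSpace (𝓡 m) x) (hX : InLieAlgebraGeneratedBy F X)
      (hY : InLieAlgebraGeneratedBy F Y) :
      InLieAlgebraGeneratedBy F (VectorField.mlieBracket (𝓡 m) X Y)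

/-- `F` is bracket-generating: at every point, the Lie algebra generated by `F` spans the whole
tangent space. -/
def IsBracketGenerating (F : Set ((x : M) → TangentSpace (𝓡 m) x)) : Prop :=
  ∀ (p : M) (v : TangentSpace (𝓡 m) p), ∃ X, InLieAlgebraGeneratedBy F X ∧ X p = v

/-- `FlowsTo X t p q` says that the flow `Φ_X^t(p)` is defined and equals `q`: there is an
integral curve of `X`, on an open interval containing `0` and `t`, which is at `p` at time `0`
and at `q` at time `t`. On a Hausdorff manifold `q` is unique if `X` is locally Lipschitz. -/
def FlowsTo (X : (x : M) → TangentSpace (𝓡 m) x) (t : ℝ) (p q : M) : Prop :=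
  ∃ (γ : ℝ → M) (a b : ℝ), (0 : ℝ) ∈ Ioo a b ∧ t ∈ Ioo a b ∧
    IsMIntegralCurveOn γ X (Ioo a b) ∧ γ 0 = p ∧ γ t = q

/-- The concatenation `Φ_{X_ℓ}^{t_ℓ} ∘ ⋯ ∘ Φ_{X_1}^{t_1} (o)` is defined and equals `q`. -/
def ConcatenationFlowsTo {l : ℕ} (X : Fin l → (x : M) → TangentSpace (𝓡 m) x) (t : Fin l → ℝ)
    (o q : M) : Prop :=
  ∃ c : Fin (l + 1) → M, c 0 = o ∧ c (Fin.last l) = q ∧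
    ∀ i : Fin l, FlowsTo (X i) (t i) (c i.castSucc) (c i.succ)

/-- A family `F` of (locally Lipschitz) vector fields on a manifold of dimension `m ≥ 1` is
essentially non-holonomic: for all `T > 0` and `o` there are `X_1, …, X_m ∈ F` and a time vector
`that` with `|that|₁ < T` such that `φ(t) = Φ_{X_m}^{t_m} ∘ ⋯ ∘ Φ_{X_1}^{t_1}(o)` is defined on an
open neighborhood `Ω` of `that`, inside the `ℓ¹`-ball of radius `T`, and is a continuous map
`Ω → M` that is essentially open at `that` (at some scale `U ⊆ Ω`). -/
def EssentiallyNonHolonomic (F : Set ((x : M) → TangentSpace (𝓡 m) x)) : Prop :=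
  ∀ T : ℝ, 0 < T → ∀ o : M,
    ∃ (X : Fin m → (x : M) → TangentSpace (𝓡 m) x) (that : EuclideanSpace ℝ (Fin m)),
      (∀ i, X i ∈ F) ∧ ∑ i, |that i| < T ∧
      ∃ (Ω : Set (EuclideanSpace ℝ (Fin m))) (hΩ : that ∈ Ω) (φ : C(Ω, M)) (U : Set Ω),
        IsOpen Ω ∧ (∀ t ∈ Ω, ∑ i, |t i| < T) ∧
        (∀ t : Ω, ConcatenationFlowsTo X (t : EuclideanSpace ℝ (Fin m)) o (φ t)) ∧
        EssentiallyOpenAt m φ ⟨that, hΩ⟩ U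

end VectorFields

/-! In a chart at `o`, concatenated flows of fields of the family are built into immersions of
growing dimension. Suppose `φ` is such a `C^2` immersion of an open set of `ℝ^k` with `k < m`. If
every field of the family were tangent to `φ` at every parameter, the whole generated Lie algebra
would be, because brackets of tangent fields are tangent (`lieBracket_mem_range_fderiv`). Bracket
generation would then make the differential surjective, which is impossible for `k < m`
(`exists_transversal`). So some field is transversal somewhere, and following its flow for a time
near zero raises the dimension by one without using up the time bound
(`IsFlowImmersion.exists_snoc`). At `k = m` the inverse function theorem makes the concatenated flow
a local homeomorphism.

The flows need `C^2` dependence on time and initial point. This comes from the inverse function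
theorem applied to the integral equation on a Banach space of curves (`exists_curve_family`,
`exists_local_flow`).

It remains to see that a local homeomorphism acts nontrivially on the homology of a small sphere
(`essentiallyOpenAt_of_openPartialHomeomorph`). The sphere carries the image of the fundamental
cycle of the boundary of a simplex, and a combinatorial cocycle detects it. Label the points of the
punctured neighbourhood so that near every point some label is missing. To a singular simplex assign
the signed number of cells of its `K`-th barycentric subdivision that carry all labels except `0`,
as a germ in `K → ∞`. Once the mesh is small no cell of one dimension higher is fully labelled, so
this is a cocycle (`d_labelHom`). On the fundamental cycle Sperner's lemma gives the value `1`
(`sphereClass_ne_zero`). -/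

/-! ### Ordered chains and barycentric subdivision -/

/-- Integral chains on ordered tuples of `n` points of `P`; the empty tuple gives the
augmentation. -/
abbrev OrdChain (P : Type*) (n : ℕ) := (Fin n → P) →₀ ℤ

theorem Finsupp.map_mem_of_mem_supported {α M : Type*} [AddCommGroup M] (f : (α →₀ ℤ) →ₗ[ℤ] M)
    {S : Set α} {p : Submodule ℤ M} (h : ∀ s ∈ S, f (Finsupp.single s 1) ∈ p) {c : α →₀ ℤ}
    (hc : c ∈ Finsupp.supported ℤ ℤ S) : f c ∈ p := by
  rw [Finsupp.supported_eq_span_single] at hc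
  have : Submodule.span ℤ ((fun i => Finsupp.single i (1 : ℤ)) '' S) ≤ p.comap f := by
    rw [Submodule.span_le]
    rintro _ ⟨s, hs, rfl⟩
    exact h s hs
  exact this hc

namespace OrdChain

variable {P Q : Type*}

/-- The alternating sum of the faces. -/
noncomputable def boundary (n : ℕ) : OrdChain P (n + 1) →ₗ[ℤ] OrdChain P n :=
  Finsupp.linearCombination ℤ fun t =>
    ∑ i : Fin (n + 1), (-1 : ℤ) ^ (i : ℕ) • Finsupp.single (t ∘ i.succAbove) 1

/-- The cone with apex `p`. -/
noncomputable def cone (n : ℕ) (p : P) : OrdChain P n →ₗ[ℤ] OrdChain P (n + 1) :=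
  Finsupp.lmapDomain ℤ ℤ fun t => (Fin.cons p t : Fin (n + 1) → P)

/-- The pushforward of chains. -/
noncomputable def push (n : ℕ) (f : P → Q) : OrdChain P n →ₗ[ℤ] OrdChain Q n :=
  Finsupp.lmapDomain ℤ ℤ fun t => f ∘ t

theorem boundary_single {n : ℕ} (t : Fin (n + 1) → P) :
    boundary n (Finsupp.single t 1) =
      ∑ i : Fin (n + 1), (-1 : ℤ) ^ (i : ℕ) • Finsupp.single (t ∘ i.succAbove) 1 := by
  simp [boundary]

@[simp]
theorem cone_single {n : ℕ} (p : P) (t : Fin n → P) :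
    cone n p (Finsupp.single t 1) = Finsupp.single (Fin.cons p t : Fin (n + 1) → P) 1 := by
  simp [cone]

@[simp]
theorem push_single {n : ℕ} (f : P → Q) (t : Fin n → P) :
    push n f (Finsupp.single t 1) = Finsupp.single (f ∘ t) 1 := by
  simp [push]

theorem push_push {R : Type*} {n : ℕ} (f : P → Q) (g : Q → R) (c : OrdChain P n) :
    push n g (push n f c) = push n (g ∘ f) c := by
  have : push n g ∘ₗ push n f = push n (g ∘ f) := by
    ext t : 2
    simp [Function.comp_assoc]
  exact LinearMap.congr_fun this c

theorem boundary_push {n : ℕ} (f : P → Q) (c : OrdChain P (n + 1)) :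
    boundary n (push (n + 1) f c) = push n f (boundary n c) := by
  have : boundary n ∘ₗ push (n + 1) f = push n f ∘ₗ boundary n := by
    ext t : 2
    simp only [LinearMap.comp_apply, Finsupp.lsingle_apply, push_single, boundary_single, map_sum,
      map_smul, Function.comp_assoc]
  exact LinearMap.congr_fun this c

theorem push_cone {n : ℕ} (f : P → Q) (p : P) (c : OrdChain P n) :
    push (n + 1) f (cone n p c) = cone n (f p) (push n f c) := by
  have : push (n + 1) f ∘ₗ cone n p = cone n (f p) ∘ₗ push n f := by
    ext t : 2
    simp only [LinearMap.comp_apply, Finsupp.lsingle_apply, cone_single, push_single]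
    congr 1
    ext i
    refine Fin.cases ?_ (fun j => ?_) i <;> simp
  exact LinearMap.congr_fun this c

theorem boundary_cone_zero (p : P) (c : OrdChain P 0) : boundary 0 (cone 0 p c) = c := by
  have : boundary 0 ∘ₗ cone 0 p = LinearMap.id := by
    ext t : 2
    simp only [LinearMap.comp_apply, Finsupp.lsingle_apply, cone_single, boundary_single,
      LinearMap.id_apply]
    rw [Fin.sum_univ_one, Fin.val_zero, pow_zero, one_smul]
    congr 1
  exact LinearMap.congr_fun this c

theorem boundary_cone_succ {n : ℕ} (p : P) (c : OrdChain P (n + 1)) :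
    boundary (n + 1) (cone (n + 1) p c) = c - cone n p (boundary n c) := by
  have : boundary (n + 1) ∘ₗ cone (n + 1) p = LinearMap.id - cone n p ∘ₗ boundary n := by
    ext t : 2
    simp only [LinearMap.comp_apply, Finsupp.lsingle_apply, cone_single, boundary_single,
      LinearMap.id_apply, LinearMap.sub_apply, map_sum, map_smul]
    rw [Fin.sum_univ_succ, sub_eq_add_neg, ← Finset.sum_neg_distrib]
    congr 1
    · simp only [Fin.val_zero, pow_zero, one_smul]
      congr 1
    · refine Finset.sum_congr rfl fun i _ => ?_
      rw [← neg_smul, Fin.val_succ, pow_succ, mul_neg_one]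
      congr 2
      ext j
      refine Fin.cases ?_ (fun j => ?_) j <;> simp
  exact LinearMap.congr_fun this c

/-- Every nonempty tuple is the cone over its tail from its first point, so the cone formula reduces
the claim to one degree lower. -/
theorem boundary_boundary {n : ℕ} (c : OrdChain P (n + 2)) :
    boundary n (boundary (n + 1) c) = 0 := by
  induction n with
  | zero =>
    have : boundary 0 ∘ₗ boundary 1 = (0 : OrdChain P 2 →ₗ[ℤ] OrdChain P 0) := by
      ext t : 2
      obtain ⟨p, s, rfl⟩ : ∃ p s, t = Fin.cons p s := ⟨t 0, Fin.tail t, (Fin.cons_self_tail t).symm⟩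
      simp only [LinearMap.comp_apply, Finsupp.lsingle_apply, LinearMap.zero_apply]
      rw [← cone_single, boundary_cone_succ, map_sub, boundary_cone_zero, sub_self]
    exact LinearMap.congr_fun this c
  | succ n ih =>
    have : boundary (n + 1) ∘ₗ boundary (n + 2) = (0 : OrdChain P _ →ₗ[ℤ] OrdChain P _) := by
      ext t : 2
      obtain ⟨p, s, rfl⟩ : ∃ p s, t = Fin.cons p s := ⟨t 0, Fin.tail t, (Fin.cons_self_tail t).symm⟩
      simp only [LinearMap.comp_apply, Finsupp.lsingle_apply, LinearMap.zero_apply]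
      rw [← cone_single, boundary_cone_succ, map_sub, boundary_cone_succ, ih]
      simp
    exact LinearMap.congr_fun this c

/-- Barycentric subdivision, for a choice `b` of the barycentres. -/
noncomputable def sd (b : ∀ n, (Fin (n + 1) → P) → P) : ∀ n, OrdChain P n →ₗ[ℤ] OrdChain P n
  | 0 => LinearMap.id
  | n + 1 => Finsupp.linearCombination ℤ fun t =>
      cone n (b n t) (sd b n (boundary n (Finsupp.single t 1)))

theorem sd_single (b : ∀ n, (Fin (n + 1) → P) → P) {n : ℕ} (t : Fin (n + 1) → P) :
    sd b (n + 1) (Finsupp.single t 1) =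
      cone n (b n t) (sd b n (boundary n (Finsupp.single t 1))) := by
  simp [sd]

theorem boundary_sd (b : ∀ n, (Fin (n + 1) → P) → P) {n : ℕ} (c : OrdChain P (n + 1)) :
    boundary n (sd b (n + 1) c) = sd b n (boundary n c) := by
  induction n with
  | zero =>
    have : boundary 0 ∘ₗ sd b 1 = sd b 0 ∘ₗ boundary 0 := by
      ext t : 2
      simp only [LinearMap.comp_apply, Finsupp.lsingle_apply]
      rw [sd_single, boundary_cone_zero]
    exact LinearMap.congr_fun this c
  | succ n ih =>
    have : boundary (n + 1) ∘ₗ sd b (n + 2) = sd b (n + 1) ∘ₗ boundary (n + 1) := by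
      ext t : 2
      simp only [LinearMap.comp_apply, Finsupp.lsingle_apply]
      rw [sd_single, boundary_cone_succ, ih, boundary_boundary, map_zero, map_zero, sub_zero]
    exact LinearMap.congr_fun this c

theorem push_sd (b : ∀ n, (Fin (n + 1) → P) → P) (b' : ∀ n, (Fin (n + 1) → Q) → Q) (f : P → Q)
    (hf : ∀ n t, f (b n t) = b' n (f ∘ t)) {n : ℕ} (c : OrdChain P n) :
    push n f (sd b n c) = sd b' n (push n f c) := by
  induction n with
  | zero => rfl
  | succ n ih =>
    have : push (n + 1) f ∘ₗ sd b (n + 1) = sd b' (n + 1) ∘ₗ push (n + 1) f := by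
      ext t : 2
      simp only [LinearMap.comp_apply, Finsupp.lsingle_apply]
      rw [sd_single, push_cone, ih, push_single, sd_single, hf, ← push_single, boundary_push]
    exact LinearMap.congr_fun this c

theorem boundary_sd_iterate (b : ∀ n, (Fin (n + 1) → P) → P) {n : ℕ} (K : ℕ)
    (c : OrdChain P (n + 1)) :
    boundary n ((sd b (n + 1))^[K] c) = (sd b n)^[K] (boundary n c) := by
  induction K generalizing c with
  | zero => rfl
  | succ K ih => rw [Function.iterate_succ_apply, Function.iterate_succ_apply, ih, boundary_sd]

theorem push_sd_iterate (b : ∀ n, (Fin (n + 1) → P) → P) (b' : ∀ n, (Fin (n + 1) → Q) → Q)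
    (f : P → Q) (hf : ∀ n t, f (b n t) = b' n (f ∘ t)) {n : ℕ} (K : ℕ) (c : OrdChain P n) :
    push n f ((sd b n)^[K] c) = (sd b' n)^[K] (push n f c) := by
  induction K generalizing c with
  | zero => rfl
  | succ K ih => rw [Function.iterate_succ_apply, Function.iterate_succ_apply, ih,
      push_sd b b' f hf]

theorem push_mem_supported {n : ℕ} (f : P → Q) {S : Set (Fin n → P)} {T : Set (Fin n → Q)}
    (h : ∀ s ∈ S, f ∘ s ∈ T) {c : OrdChain P n} (hc : c ∈ Finsupp.supported ℤ ℤ S) :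
    push n f c ∈ Finsupp.supported ℤ ℤ T := by
  refine Finsupp.map_mem_of_mem_supported _ (fun s hs => ?_) hc
  rw [push_single]
  exact Finsupp.single_mem_supported _ _ (h s hs)

/-! ### Decay of the mesh under subdivision. -/

section Mesh

variable [PseudoMetricSpace P]

/-- The intersection of the closed balls that contain a tuple. -/
def ballHull {n : ℕ} (t : Fin n → P) : Set P :=
  {x | ∀ y r, (∀ j, dist (t j) y ≤ r) → dist x y ≤ r}

/-- The choice `b` of barycentres contracts tuples of at most `N` points by the factor `ρ`. -/
structure IsContracting (b : ∀ n, (Fin (n + 1) → P) → P) (N : ℕ) (ρ : ℝ) : Prop where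
  nonneg : 0 ≤ ρ
  mem_hull : ∀ n t, b n t ∈ ballHull t
  dist_le : ∀ n t D, n < N → (∀ i j, dist (t i) (t j) ≤ D) → ∀ j, dist (t j) (b n t) ≤ ρ * D

/-- Edges inside a face are short by induction. For edges at the apex, the closed ball of radius `ρ
* D` about the barycentre contains the points of `t`, hence their hull, where all new vertices lie.
Keeping track of the hull is what makes the induction close. -/
theorem sd_mem_supported {b : ∀ n, (Fin (n + 1) → P) → P} {N : ℕ} {ρ : ℝ}
    (hb : IsContracting b N ρ) {n : ℕ} (hn : n ≤ N) {D : ℝ} (hD : 0 ≤ D) (t : Fin n → P)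
    (ht : ∀ i j, dist (t i) (t j) ≤ D) :
    sd b n (Finsupp.single t 1) ∈ Finsupp.supported ℤ ℤ
      {s | (∀ i, s i ∈ ballHull t) ∧ ∀ i j, dist (s i) (s j) ≤ ρ * D} := by
  induction n with
  | zero => exact Finsupp.single_mem_supported _ _ ⟨fun i => i.elim0, fun i => i.elim0⟩
  | succ n ih =>
    rw [sd_single]
    refine Finsupp.map_mem_of_mem_supported (cone n (b n t)) (S := {s | (∀ i, s i ∈ ballHull t) ∧
      ∀ i j, dist (s i) (s j) ≤ ρ * D}) (fun s hs => ?_) ?_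
    · rw [cone_single]
      refine Finsupp.single_mem_supported _ _ ⟨fun i => ?_, fun i j => ?_⟩
      · refine Fin.cases ?_ (fun j => ?_) i
        · simpa using! hb.mem_hull n t
        · simpa using! hs.1 j
      · have h0 : 0 ≤ ρ * D := mul_nonneg hb.nonneg hD
        have h1 := hb.dist_le n t D hn ht
        refine Fin.cases ?_ (fun i => ?_) i <;> refine Fin.cases ?_ (fun j => ?_) j
        · simpa using h0
        · simpa [dist_comm] using hs.1 j _ _ h1
        · simpa using hs.1 i _ _ h1
        · simpa using hs.2 i j
    · rw [boundary_single, map_sum]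
      refine Submodule.sum_mem _ fun i _ => ?_
      rw [map_smul]
      refine Submodule.smul_mem _ _ ?_
      refine Finsupp.supported_mono ?_ (ih (by omega) (t ∘ i.succAbove) fun a c => ht _ _)
      rintro s ⟨h1, h2⟩
      exact ⟨fun a y r h => h1 a y r fun j => h _, h2⟩

theorem sd_iterate_mem_supported {b : ∀ n, (Fin (n + 1) → P) → P} {N : ℕ} {ρ : ℝ}
    (hb : IsContracting b N ρ) {n : ℕ} (hn : n ≤ N) {D : ℝ} (hD : 0 ≤ D) (t : Fin n → P)
    (ht : ∀ i j, dist (t i) (t j) ≤ D) (K : ℕ) :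
    (sd b n)^[K] (Finsupp.single t 1) ∈ Finsupp.supported ℤ ℤ
      {s | ∀ i j, dist (s i) (s j) ≤ ρ ^ K * D} := by
  induction K with
  | zero => exact Finsupp.single_mem_supported _ _ (by simpa using ht)
  | succ K ih =>
    rw [Function.iterate_succ_apply']
    refine Finsupp.map_mem_of_mem_supported _ (fun s hs => ?_) ih
    refine Finsupp.supported_mono ?_ (sd_mem_supported hb hn
      (mul_nonneg (pow_nonneg hb.nonneg K) hD) s hs)
    rintro s ⟨-, h2⟩ i j
    rw [pow_succ', mul_assoc]
    exact h2 i j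

end Mesh

/-! ### Counting fully labelled tuples -/

/-- The signed count of the tuples that carry all the labels. -/
noncomputable def labelDet (k : ℕ) : OrdChain (Fin (k + 1)) (k + 1) →ₗ[ℤ] ℤ :=
  Finsupp.linearCombination ℤ fun t =>
    Matrix.det (Matrix.of fun i j : Fin (k + 1) => if t i = j then (1 : ℤ) else 0)

/-- The signed count of the tuples that carry all the labels except `0`. -/
noncomputable def labelCochain (k : ℕ) : OrdChain (Fin (k + 1)) k →ₗ[ℤ] ℤ :=
  Finsupp.linearCombination ℤ fun t =>
    Matrix.det (Matrix.of fun i j : Fin k => if t i = j.succ then (1 : ℤ) else 0)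

/-- Each row of the incidence matrix has a single `1`, so adding all columns to column `0` turns it
into a column of ones. Laplace expansion along it is the alternating sum over the faces. -/
theorem labelCochain_boundary {k : ℕ} (c : OrdChain (Fin (k + 1)) (k + 1)) :
    labelCochain k (boundary k c) = labelDet k c := by
  have : labelCochain k ∘ₗ boundary k = labelDet k := by
    ext t : 2
    simp only [LinearMap.comp_apply, Finsupp.lsingle_apply, boundary_single, map_sum, map_smul]
    simp only [labelCochain, labelDet, Finsupp.linearCombination_single, one_smul]
    set A : Matrix (Fin (k + 1)) (Fin (k + 1)) ℤ :=
      Matrix.of fun i j => if t i = j then (1 : ℤ) else 0 with hA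
    have h := Matrix.det_updateCol_sum A 0 (fun _ => (1 : ℤ))
    rw [one_smul] at h
    rw [← h, Matrix.det_succ_column_zero]
    refine Finset.sum_congr rfl fun i _ => ?_
    have h1 : (A.updateCol 0 fun k => ∑ i, (1 : ℤ) • A k i) i 0 = 1 := by
      simp [hA]
    rw [h1, mul_one, smul_eq_mul]
    congr 2
  exact LinearMap.congr_fun this c

theorem labelDet_eq_zero {k : ℕ} {c : OrdChain (Fin (k + 1)) (k + 1)}
    (hc : c ∈ Finsupp.supported ℤ ℤ {s | ∃ a, ∀ i, s i ≠ a}) : labelDet k c = 0 := by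
  have := Finsupp.map_mem_of_mem_supported (labelDet k) (p := ⊥) (fun s hs => ?_) hc
  · simpa using this
  · obtain ⟨a, ha⟩ := hs
    simp only [labelDet, Finsupp.linearCombination_single, one_smul, Submodule.mem_bot]
    exact Matrix.det_eq_zero_of_column_eq_zero a fun i => by simp [ha i]

theorem labelCochain_eq_zero {k : ℕ} {c : OrdChain (Fin (k + 1)) k} (j : Fin k)
    (hc : c ∈ Finsupp.supported ℤ ℤ {s | ∀ i, s i ≠ j.succ}) : labelCochain k c = 0 := by
  have := Finsupp.map_mem_of_mem_supported (labelCochain k) (p := ⊥) (fun s hs => ?_) hc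
  · simpa using this
  · simp only [labelCochain, Finsupp.linearCombination_single, one_smul, Submodule.mem_bot]
    exact Matrix.det_eq_zero_of_column_eq_zero j fun i => by simp [hs i]

theorem labelCochain_push_succ {k : ℕ} (c : OrdChain (Fin (k + 1)) (k + 1)) :
    labelCochain (k + 1) (push (k + 1) Fin.succ c) = labelDet k c := by
  have : labelCochain (k + 1) ∘ₗ push (k + 1) Fin.succ = labelDet k := by
    ext t : 2
    simp [labelCochain, labelDet]
  exact LinearMap.congr_fun this c

theorem push_mem_supported_avoid {n : ℕ} (f : P → Q) {T : Set (Fin n → Q)}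
    (h : ∀ s, f ∘ s ∈ T) (c : OrdChain P n) :
    push n f c ∈ Finsupp.supported ℤ ℤ T :=
  push_mem_supported (S := Set.univ) f (fun s _ => h s) (by simp)

end OrdChain

/-! ### Subdivision of the standard simplex -/

namespace stdSimplex

variable {ι κ : Type*} [Fintype ι] [Fintype κ]

/-- The barycentre of a tuple of points of a standard simplex. -/
noncomputable def average (n : ℕ) (t : Fin (n + 1) → stdSimplex ℝ ι) : stdSimplex ℝ ι :=
  ⟨∑ i, ((n + 1 : ℝ)⁻¹) • (t i : ι → ℝ),
    (convex_stdSimplex ℝ ι).sum_mem (fun _ _ => by positivity)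
      (by simp; field_simp) (fun i _ => (t i).2)⟩

theorem average_coe (n : ℕ) (t : Fin (n + 1) → stdSimplex ℝ ι) :
    ⇑(average n t) = ∑ i, ((n + 1 : ℝ)⁻¹) • ⇑(t i) := rfl

theorem map_average (f : ι → κ) (n : ℕ) (t : Fin (n + 1) → stdSimplex ℝ ι) :
    map f (average n t) = average n (map f ∘ t) := by
  refine stdSimplex.ext ?_
  simp only [average_coe, map_coe, map_sum, map_smul, Function.comp_apply]

theorem dist_average_le {n : ℕ} (t : Fin (n + 1) → stdSimplex ℝ ι) (y : stdSimplex ℝ ι)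
    (d : Fin (n + 1) → ℝ) (hd : ∀ i, dist (t i) y ≤ d i) :
    dist (average n t) y ≤ (n + 1 : ℝ)⁻¹ * ∑ i, d i := by
  have h : ⇑(average n t) - ⇑y = ∑ i, ((n + 1 : ℝ)⁻¹) • (⇑(t i) - ⇑y) := by
    rw [← Finset.smul_sum, Finset.sum_sub_distrib, smul_sub, Finset.smul_sum]
    simp only [average_coe, Finset.sum_const, Finset.card_univ, Fintype.card_fin]
    rw [← Nat.cast_smul_eq_nsmul ℝ, smul_smul]
    push_cast
    rw [inv_mul_cancel₀ (by positivity), one_smul]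
  change ‖⇑(average n t) - ⇑y‖ ≤ _
  rw [h, Finset.mul_sum]
  refine norm_sum_le_of_le _ fun i _ => ?_
  rw [norm_smul, Real.norm_of_nonneg (by positivity)]
  exact mul_le_mul_of_nonneg_left (hd i) (by positivity)

theorem isContracting_average (N : ℕ) :
    OrdChain.IsContracting (average (ι := ι)) N (1 - (N : ℝ)⁻¹) where
  nonneg := by
    have := Nat.cast_inv_le_one (α := ℝ) N
    linarith
  mem_hull n t y r h := by
    refine (dist_average_le t y (fun _ => r) h).trans_eq ?_
    simp only [Finset.sum_const, Finset.card_univ, Fintype.card_fin, nsmul_eq_mul]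
    push_cast
    field_simp
  dist_le n t D hn ht j := by
    have hD : 0 ≤ D := (dist_nonneg).trans (ht 0 0)
    rw [dist_comm]
    refine (dist_average_le t (t j) (fun i => if i = j then 0 else D) fun i => ?_).trans ?_
    · split_ifs with h
      · simp [h]
      · exact ht i j
    · rw [Finset.sum_ite, Finset.sum_const_zero, zero_add, Finset.sum_const, nsmul_eq_mul,
        ← mul_assoc]
      refine mul_le_mul_of_nonneg_right ?_ hD
      rw [Finset.filter_ne', Finset.card_erase_of_mem (Finset.mem_univ j), Finset.card_univ,
        Fintype.card_fin, Nat.add_sub_cancel]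
      have hN : ((n + 1 : ℕ) : ℝ) ≤ N := by exact_mod_cast hn
      push_cast at hN
      have h1 : (N : ℝ)⁻¹ ≤ (n + 1 : ℝ)⁻¹ := inv_anti₀ (by positivity) hN
      have h2 : (n + 1 : ℝ)⁻¹ * n = 1 - (n + 1 : ℝ)⁻¹ := by field_simp; ring
      linarith

/-- The iterated barycentric subdivision of the simplex of dimension `q`. -/
noncomputable def subdivision (q K : ℕ) : OrdChain (stdSimplex ℝ (Fin (q + 1))) (q + 1) :=
  (OrdChain.sd average (q + 1))^[K] (Finsupp.single vertex 1)

theorem boundary_push_subdivision {Λ : Type*} (q K : ℕ)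
    (l : stdSimplex ℝ (Fin (q + 2)) → Λ) :
    OrdChain.boundary (q + 1) (OrdChain.push (q + 2) l (subdivision (q + 1) K)) =
      ∑ i : Fin (q + 2), (-1 : ℤ) ^ (i : ℕ) •
        OrdChain.push (q + 1) (l ∘ map i.succAbove) (subdivision q K) := by
  rw [OrdChain.boundary_push, subdivision, OrdChain.boundary_sd_iterate, OrdChain.boundary_single]
  -- Writing the iterate as a power of a linear endomorphism lets it pass through the sum over
  -- faces.
  have (c : OrdChain (stdSimplex ℝ (Fin (q + 2))) (q + 1)) :
      (OrdChain.sd average (q + 1))^[K] c = ((OrdChain.sd average (q + 1)) ^ K) c :=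
    (Module.End.pow_apply _ _ _).symm
  rw [this, map_sum, map_sum]
  refine Finset.sum_congr rfl fun i _ => ?_
  rw [map_smul, map_smul, ← this, ← OrdChain.push_push, subdivision,
    OrdChain.push_sd_iterate average average _ (map_average _), OrdChain.push_single]
  have : (map i.succAbove ∘ vertex : Fin (q + 1) → stdSimplex ℝ (Fin (q + 2))) =
      vertex ∘ i.succAbove := by
    funext j
    simp
  rw [this]

/-- Sperner's lemma for iterated barycentric subdivisions. -/
theorem labelDet_push_subdivision (q K : ℕ) (l : stdSimplex ℝ (Fin (q + 1)) → Fin (q + 1))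
    (hl : ∀ x : stdSimplex ℝ (Fin (q + 1)), x (l x) ≠ 0) :
    OrdChain.labelDet q (OrdChain.push (q + 1) l (subdivision q K)) = 1 := by
  induction q with
  | zero =>
    have h : ∀ K, subdivision 0 K = Finsupp.single vertex 1 := by
      intro K
      induction K with
      | zero => rfl
      | succ K ih =>
        rw [subdivision, Function.iterate_succ_apply', ← subdivision, ih, OrdChain.sd_single,
          OrdChain.boundary_single, Fin.sum_univ_one, Fin.val_zero, pow_zero, one_smul,
          OrdChain.sd, LinearMap.id_apply, OrdChain.cone_single]
        congr 1
        exact Subsingleton.elim _ _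
    rw [h, OrdChain.push_single]
    simp [OrdChain.labelDet, (Fin.fin_one_eq_zero (l (vertex 0)) : _)]
  | succ q ih =>
    -- Count on the boundary. The face opposite a vertex `i ≥ 1` never uses the label `i`, so it
    -- contributes nothing. The face opposite `0` uses only nonzero labels and, after a shift of
    -- labels, is the case of dimension `q`.
    rw [← OrdChain.labelCochain_boundary, boundary_push_subdivision, map_sum, Fin.sum_univ_succ,
      Finset.sum_eq_zero, add_zero]
    · rw [Fin.val_zero, pow_zero, one_smul]
      have h0 : ∀ y : stdSimplex ℝ (Fin (q + 1)), l (map Fin.succ y) ≠ 0 := by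
        intro y h
        apply hl (map Fin.succ y)
        rw [h, map_coe, FunOnFinite.linearMap_apply_apply]
        simp [Fin.succ_ne_zero]
      set l' : stdSimplex ℝ (Fin (q + 1)) → Fin (q + 1) :=
        fun y => (l (map Fin.succ y)).pred (h0 y) with hl'
      have h1 : l ∘ map (Fin.succAbove 0) = Fin.succ ∘ l' := by
        ext1 y
        simp [hl', Fin.succAbove_zero]
      rw [h1, ← OrdChain.push_push, OrdChain.labelCochain_push_succ]
      apply ih
      intro y
      have := hl (map Fin.succ y)
      rw [← Fin.succ_pred _ (h0 y), map_coe, FunOnFinite.linearMap_apply_apply] at this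
      simpa [Fin.succ_inj, Finset.filter_eq', -Fin.succ_pred] using this
    · intro i _
      rw [map_smul, OrdChain.labelCochain_eq_zero i, smul_zero]
      refine OrdChain.push_mem_supported_avoid _ (fun s j h => ?_) _
      apply hl (map i.succ.succAbove (s j))
      have h' : l (map i.succ.succAbove (s j)) = i.succ := h
      rw [h', map_coe, FunOnFinite.linearMap_apply_apply]
      simp [Fin.succAbove_ne]

/-- By compactness there is a Lebesgue number for the open sets that avoid one label; once the mesh
is below it, no cell carries all labels. -/
theorem eventually_labelDet_push_subdivision_eq_zero {q : ℕ}
    (l : stdSimplex ℝ (Fin (q + 1)) → Fin (q + 1)) (hl : ∀ x, ∃ a, ∀ᶠ y in 𝓝 x, l y ≠ a) :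
    ∀ᶠ K in Filter.atTop,
      OrdChain.labelDet q (OrdChain.push (q + 1) l (subdivision q K)) = 0 := by
  obtain ⟨δ, hδ, h⟩ := lebesgue_number_lemma_of_metric (s := (univ : Set (stdSimplex ℝ (Fin (q + 1)))))
    (c := fun a : Fin (q + 1) => interior {y | l y ≠ a}) isCompact_univ
    (fun _ => isOpen_interior) (fun x _ => by
      obtain ⟨a, ha⟩ := hl x
      exact mem_iUnion.2 ⟨a, mem_interior_iff_mem_nhds.2 ha⟩)
  set D := Metric.diam (univ : Set (stdSimplex ℝ (Fin (q + 1)))) with hD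
  have hD0 : 0 ≤ D := Metric.diam_nonneg
  have hc := isContracting_average (ι := Fin (q + 1)) (q + 1)
  have hlim : Filter.Tendsto (fun K : ℕ => (1 - ((q + 1 : ℕ) : ℝ)⁻¹) ^ K * D) Filter.atTop
      (𝓝 (0 * D)) := by
    refine (tendsto_pow_atTop_nhds_zero_of_lt_one hc.nonneg ?_).mul_const D
    have : (0 : ℝ) < ((q + 1 : ℕ) : ℝ)⁻¹ := by positivity
    linarith
  rw [zero_mul] at hlim
  filter_upwards [hlim.eventually_lt_const hδ] with K hK
  apply OrdChain.labelDet_eq_zero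
  refine OrdChain.push_mem_supported _ (fun s hs => ?_) (OrdChain.sd_iterate_mem_supported hc le_rfl hD0
    vertex (fun i j => Metric.dist_le_diam_of_mem isCompact_univ.isBounded (mem_univ _)
      (mem_univ _)) K)
  obtain ⟨a, ha⟩ := h (s 0) (mem_univ _)
  exact ⟨a, fun i => interior_subset (ha (Metric.mem_ball.2 ((hs i 0).trans_lt hK)))⟩

end stdSimplex

/-! ### Singular cycles and cochains -/

section SingularCycles

universe u v

open CategoryTheory Limits Simplicial

namespace HomologicalComplex

variable {C : Type u} [Category.{v} C] [Preadditive C] [CategoryWithHomology C]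
  {K L : ChainComplex C ℕ} {A : C} {n : ℕ}

/-- The homology class of a cycle with coefficients in `A`. -/
noncomputable def cycleClass (z : A ⟶ K.X n) (hz : z ≫ K.d n ((ComplexShape.down ℕ).next n) = 0) :
    A ⟶ K.homology n :=
  K.liftCycles z _ rfl hz ≫ K.homologyπ n

theorem cycleClass_map (φ : K ⟶ L) (z : A ⟶ K.X n)
    (hz : z ≫ K.d n ((ComplexShape.down ℕ).next n) = 0) (w : A ⟶ L.X n)
    (hw : w ≫ L.d n ((ComplexShape.down ℕ).next n) = 0) (h : z ≫ φ.f n = w) :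
    cycleClass z hz ≫ homologyMap φ n = cycleClass w hw := by
  subst h
  simp [cycleClass]

theorem cycleClass_eq_zero (z : A ⟶ K.X n)
    (hz : z ≫ K.d n ((ComplexShape.down ℕ).next n) = 0) (w : A ⟶ K.X (n + 1))
    (h : z = w ≫ K.d (n + 1) n) : cycleClass z hz = 0 :=
  K.liftCycles_homologyπ_eq_zero_of_boundary z _ rfl w h

/-- A cochain that kills boundaries factors through opcycles, so its value on a cycle depends only
on the homology class. -/
theorem cycleClass_ne_zero (z : A ⟶ K.X n)
    (hz : z ≫ K.d n ((ComplexShape.down ℕ).next n) = 0) {B : C} (f : K.X n ⟶ B)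
    (hf : K.d (n + 1) n ≫ f = 0) (h : z ≫ f ≠ 0) : cycleClass z hz ≠ 0 := by
  intro h0
  apply h
  have h1 : cycleClass z hz ≫ K.homologyι n ≫ K.descOpcycles f (n + 1) (by simp) hf = z ≫ f := by
    simp [cycleClass]
  rw [← h1, h0, zero_comp]

end HomologicalComplex

namespace TopCat

variable {X Y : TopCat.{u}} {n : ℕ}

/-- The continuous map underlying a singular simplex. -/
noncomputable def simplexMap (x : (TopCat.toSSet.obj X) _⦋n⦌) :
    C(stdSimplex ℝ (Fin (n + 1)), X) :=
  X.toSSetObjEquiv _ x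

/-- The singular simplex given by a continuous map. -/
noncomputable def simplexOf (s : C(stdSimplex ℝ (Fin (n + 1)), X)) : (TopCat.toSSet.obj X) _⦋n⦌ :=
  (X.toSSetObjEquiv _).symm s

theorem simplexMap_simplexOf (s : C(stdSimplex ℝ (Fin (n + 1)), X)) :
    simplexMap (simplexOf s) = s := by
  rw [simplexMap, simplexOf, Equiv.apply_symm_apply]

theorem simplexMap_injective :
    Function.Injective (simplexMap : (TopCat.toSSet.obj X) _⦋n⦌ → _) :=
  (X.toSSetObjEquiv _).injective

theorem simplexMap_δ (x : (TopCat.toSSet.obj X) _⦋n + 1⦌) (i : Fin (n + 2)) :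
    simplexMap ((TopCat.toSSet.obj X).δ i x) =
      (simplexMap x).comp ⟨stdSimplex.map i.succAbove, stdSimplex.continuous_map _⟩ := rfl

theorem simplexMap_app (f : X ⟶ Y) (x : (TopCat.toSSet.obj X) _⦋n⦌) :
    simplexMap ((TopCat.toSSet.map f).app _ x) = f.hom.comp (simplexMap x) := rfl

theorem toSSet_map_simplexOf (f : X ⟶ Y) (s : C(stdSimplex ℝ (Fin (n + 1)), X)) :
    (TopCat.toSSet.map f).app _ (simplexOf s) = simplexOf (f.hom.comp s) :=
  simplexMap_injective (by rw [simplexMap_app, simplexMap_simplexOf, simplexMap_simplexOf])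

end TopCat

end SingularCycles

/-- The boundary of the standard simplex of dimension `n + 1`. -/
abbrev simplexBoundary (n : ℕ) : Type :=
  {x : stdSimplex ℝ (Fin (n + 2)) // ∃ i, x i = 0}

/-- The inclusion of a face. -/
noncomputable def simplexBoundary.face {n : ℕ} (i : Fin (n + 2)) :
    C(stdSimplex ℝ (Fin (n + 1)), simplexBoundary n) where
  toFun y := ⟨stdSimplex.map i.succAbove y, i, by
    rw [stdSimplex.map_coe, FunOnFinite.linearMap_apply_apply]
    simp [Fin.succAbove_ne]⟩
  continuous_toFun := (stdSimplex.continuous_map _).subtype_mk _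

/-! ### The fundamental class of the boundary of a simplex, and a cocycle detecting it. -/

section FundamentalClass

universe u

open CategoryTheory Limits Simplicial TopCat

/-- The integers. -/
noncomputable abbrev intModule : ModuleCat.{u} ℤ := ModuleCat.of ℤ (ULift.{u} ℤ)

/-- The singular chain complex with integral coefficients. -/
noncomputable abbrev singularC (X : TopCat.{u}) : ChainComplex (ModuleCat.{u} ℤ) ℕ :=
  (TopCat.toSSet.obj X).chainComplex intModule

/-- The chain map induced by a continuous map. -/
noncomputable abbrev singularCMap {X Y : TopCat.{u}} (f : X ⟶ Y) : singularC X ⟶ singularC Y :=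
  SSet.chainComplexMap (TopCat.toSSet.map f) intModule

variable {X Y : TopCat.{u}} {n : ℕ}

/-- The image in `X` of the fundamental cycle of the boundary of a simplex. -/
noncomputable def sphereChain (s : C(simplexBoundary n, X)) : intModule ⟶ (singularC X).X n :=
  ∑ i : Fin (n + 2), (-1) ^ (i : ℕ) •
    (TopCat.toSSet.obj X).ιChainComplex (simplexOf (s.comp (simplexBoundary.face i)))

theorem sphereChain_map (f : X ⟶ Y) (s : C(simplexBoundary n, X)) :
    sphereChain s ≫ (singularCMap f).f n = sphereChain (f.hom.comp s) := by
  simp only [sphereChain, Preadditive.sum_comp, Preadditive.zsmul_comp,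
    SSet.ι_chainComplexMap_f, toSSet_map_simplexOf]
  rfl

theorem sphereChain_eq_boundary (s : C(stdSimplex ℝ (Fin (n + 2)), X))
    (s' : C(simplexBoundary n, X)) (h : ∀ x, s' x = s x.1) :
    sphereChain s' = (TopCat.toSSet.obj X).ιChainComplex (simplexOf s) ≫
      (singularC X).d (n + 1) n := by
  rw [SSet.ιChainComplex_d, sphereChain]
  refine Finset.sum_congr rfl fun i _ => ?_
  congr 2
  apply simplexMap_injective
  rw [simplexMap_δ, simplexMap_simplexOf, simplexMap_simplexOf]
  ext y
  exact h _

/-- By naturality it suffices to treat the universal case, the boundary of the simplex itself. Its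
inclusion into the full simplex is injective on chains, and there the chain is the boundary of the
identity simplex. -/
theorem sphereChain_d (s : C(simplexBoundary n, X)) :
    sphereChain s ≫ (singularC X).d n ((ComplexShape.down ℕ).next n) = 0 := by
  let B : TopCat.{u} := TopCat.of (ULift.{u} (simplexBoundary n))
  let D : TopCat.{u} := TopCat.of (ULift.{u} (stdSimplex ℝ (Fin (n + 2))))
  let j : B ⟶ D := TopCat.ofHom ⟨fun x => ULift.up x.down.1,
    continuous_uliftUp.comp (continuous_subtype_val.comp continuous_uliftDown)⟩
  let up : C(simplexBoundary n, B) := ⟨ULift.up, continuous_uliftUp⟩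
  let f : B ⟶ X := TopCat.ofHom (s.comp ⟨ULift.down, continuous_uliftDown⟩)
  have hj : Mono j := (TopCat.mono_iff_injective j).2 fun x y h =>
    ULift.down_injective (Subtype.ext (congrArg ULift.down h))
  have hp : HasFiniteLimits (ModuleCat.{u} ℤ) := Abelian.hasFiniteLimits
  have hm : Mono (singularCMap j) :=
    inferInstanceAs (Mono (((AlgebraicTopology.singularChainComplexFunctor
      (ModuleCat.{u} ℤ)).obj intModule).map j))
  have hs : s = f.hom.comp up := rfl
  have h : sphereChain up ≫ (singularC B).d n ((ComplexShape.down ℕ).next n) = 0 := by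
    have : Mono ((singularCMap j).f ((ComplexShape.down ℕ).next n)) :=
      inferInstanceAs (Mono ((HomologicalComplex.eval (ModuleCat.{u} ℤ) (ComplexShape.down ℕ)
        ((ComplexShape.down ℕ).next n)).map (singularCMap j)))
    rw [← cancel_mono ((singularCMap j).f ((ComplexShape.down ℕ).next n)), Category.assoc,
      ← HomologicalComplex.Hom.comm, ← Category.assoc, sphereChain_map,
      sphereChain_eq_boundary ⟨ULift.up, continuous_uliftUp⟩ _ fun x => rfl]
    rw [Category.assoc, HomologicalComplex.d_comp_d, comp_zero, zero_comp]
  rw [hs, ← sphereChain_map, Category.assoc, HomologicalComplex.Hom.comm, ← Category.assoc, h,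
    zero_comp]

/-- The image in the homology of `X` of the fundamental class of the boundary of a simplex. -/
noncomputable def sphereClass (s : C(simplexBoundary n, X)) : intModule ⟶ singularH n X :=
  HomologicalComplex.cycleClass (K := singularC X) (sphereChain s) (sphereChain_d s)

theorem singularHMap_sphereClass (f : X ⟶ Y) (s : C(simplexBoundary n, X)) (a : intModule) :
    singularHMap n f (sphereClass s a) = sphereClass (f.hom.comp s) a :=
  ConcreteCategory.congr_hom (HomologicalComplex.cycleClass_map (singularCMap f) _
    (sphereChain_d s) _ (sphereChain_d (f.hom.comp s)) (sphereChain_map f s)) a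

/-- The constant map to a point extends over the full simplex, so the class dies there. The argument
includes `n = 0`, where the reduced group is a proper kernel. -/
theorem sphereClass_mem_reducedH (s : C(simplexBoundary n, X)) (a : intModule) :
    sphereClass s a ∈ reducedH n X := by
  rw [reducedH, LinearMap.mem_ker, singularHMap_sphereClass]
  have : sphereClass ((toPoint X).hom.comp s) = 0 :=
    HomologicalComplex.cycleClass_eq_zero _ _ _
      (sphereChain_eq_boundary (ContinuousMap.const _ PUnit.unit) _ fun x => rfl)
  rw [this]
  rfl

/-- The germ at infinity of the cochain that counts simplices of iterated subdivisions with all the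
labels except `0`. -/
noncomputable def labelGerm (l : X → Fin (n + 2)) (x : (TopCat.toSSet.obj X) _⦋n⦌) :
    Filter.Germ (Filter.atTop : Filter ℕ) ℤ :=
  Filter.Germ.ofFun fun K => OrdChain.labelCochain (n + 1)
    (OrdChain.push (n + 1) (l ∘ simplexMap x) (stdSimplex.subdivision n K))

/-- Subdivision commutes with the boundary, so this is `labelCochain_boundary` for each `K`. The
labelling `l` need not come from a singular simplex: in `sphereClass_ne_zero` only its restriction
to the faces does. -/
theorem sum_labelGerm_eq (φ : Fin (n + 2) → stdSimplex ℝ (Fin (n + 1)) → Fin (n + 2))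
    (l : stdSimplex ℝ (Fin (n + 2)) → Fin (n + 2))
    (h : ∀ i, φ i = l ∘ stdSimplex.map i.succAbove) :
    ∑ i : Fin (n + 2), (-1 : ℤ) ^ (i : ℕ) •
      (Filter.Germ.ofFun (l := Filter.atTop) fun K => OrdChain.labelCochain (n + 1)
        (OrdChain.push (n + 1) (φ i) (stdSimplex.subdivision n K))) =
    Filter.Germ.ofFun (l := Filter.atTop) fun K => OrdChain.labelDet (n + 1)
        (OrdChain.push (n + 2) l (stdSimplex.subdivision (n + 1) K)) := by
  have (g : Fin (n + 2) → ℕ → ℤ) :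
      ∑ i : Fin (n + 2), (-1 : ℤ) ^ (i : ℕ) • (Filter.Germ.ofFun (l := Filter.atTop) (g i)) =
      Filter.Germ.ofFun (l := Filter.atTop)
        (∑ i : Fin (n + 2), (-1 : ℤ) ^ (i : ℕ) • (g i : ℕ → ℤ)) := by
    have := (map_sum (Filter.Germ.coeAddHom (Filter.atTop : Filter ℕ) (M := ℤ))
      (fun i : Fin (n + 2) => (-1 : ℤ) ^ (i : ℕ) • (g i : ℕ → ℤ)) Finset.univ).symm
    simpa only [map_zsmul] using! this
  rw [this]
  congr 1
  funext K
  rw [← OrdChain.labelCochain_boundary, stdSimplex.boundary_push_subdivision, map_sum]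
  simp only [Finset.sum_apply, Pi.smul_apply, map_smul, h]

/-- The homomorphism on singular chains defined by `labelGerm`. -/
noncomputable def labelHom (l : X → Fin (n + 2)) :
    (singularC X).X n ⟶ ModuleCat.of ℤ (ULift.{u} (Filter.Germ (Filter.atTop : Filter ℕ) ℤ)) :=
  Sigma.desc (f := fun _ : (TopCat.toSSet.obj X) _⦋n⦌ => intModule) fun x => ModuleCat.ofHom
    (ULift.moduleEquiv.symm.toLinearMap ∘ₗ (LinearMap.toSpanSingleton ℤ _ (labelGerm l x)) ∘ₗ
      ULift.moduleEquiv.toLinearMap)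

theorem ι_labelHom (l : X → Fin (n + 2)) (x : (TopCat.toSSet.obj X) _⦋n⦌) :
    (TopCat.toSSet.obj X).ιChainComplex (R := intModule) x ≫ labelHom l = ModuleCat.ofHom
    (ULift.moduleEquiv.symm.toLinearMap ∘ₗ (LinearMap.toSpanSingleton ℤ _ (labelGerm l x)) ∘ₗ
      ULift.moduleEquiv.toLinearMap) :=
  Sigma.ι_desc (f := fun _ : (TopCat.toSSet.obj X) _⦋n⦌ => intModule) _ x

theorem sum_ι_labelHom (l : X → Fin (n + 2)) (x : Fin (n + 2) → (TopCat.toSSet.obj X) _⦋n⦌) :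
    (∑ i : Fin (n + 2), (-1) ^ (i : ℕ) • (TopCat.toSSet.obj X).ιChainComplex (x i)) ≫
      labelHom l = ModuleCat.ofHom
    (ULift.moduleEquiv.symm.toLinearMap ∘ₗ (LinearMap.toSpanSingleton ℤ _
      (∑ i : Fin (n + 2), (-1 : ℤ) ^ (i : ℕ) • labelGerm l (x i))) ∘ₗ
      ULift.moduleEquiv.toLinearMap) := by
  simp only [Preadditive.sum_comp, Preadditive.zsmul_comp, ι_labelHom]
  apply ModuleCat.hom_ext
  simp only [ModuleCat.hom_sum, ModuleCat.hom_zsmul, ModuleCat.hom_ofHom]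
  ext a
  simp only [LinearMap.sum_apply, LinearMap.smul_apply, LinearMap.comp_apply,
    LinearMap.toSpanSingleton_apply, LinearEquiv.coe_coe, Finset.smul_sum, map_sum, map_smul,
    smul_comm _ (ULift.moduleEquiv a)]

/-- The number of subdivisions after which the count vanishes depends on the singular simplex. Germs
at infinity absorb this dependence and give an honest cocycle. -/
theorem d_labelHom {l : X → Fin (n + 2)} (hl : ∀ x, ∃ a, ∀ᶠ y in 𝓝 x, l y ≠ a) :
    (singularC X).d (n + 1) n ≫ labelHom l = 0 := by
  apply SSet.chainComplex_hom_ext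
  intro x
  rw [SSet.ιChainComplex_d_assoc, comp_zero]
  rw [sum_ι_labelHom]
  have h0 : ∑ i : Fin (n + 2), (-1 : ℤ) ^ (i : ℕ) • labelGerm l ((TopCat.toSSet.obj X).δ i x)
      = 0 := by
    refine (sum_labelGerm_eq _ (l ∘ simplexMap x) fun i => rfl).trans ?_
    refine Filter.Germ.coe_eq.2 (stdSimplex.eventually_labelDet_push_subdivision_eq_zero _ fun y => ?_)
    obtain ⟨a, ha⟩ := hl (simplexMap x y)
    exact ⟨a, (simplexMap x).continuous.continuousAt.eventually ha⟩
  rw [h0]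
  ext
  simp

theorem sphereClass_ne_zero {l : X → Fin (n + 2)} (hl : ∀ x, ∃ a, ∀ᶠ y in 𝓝 x, l y ≠ a)
    (s : C(simplexBoundary n, X)) (hs : ∀ x : simplexBoundary n, x.1 (l (s x)) ≠ 0) :
    sphereClass s (ULift.up 1) ≠ 0 := by
  classical
  intro h0
  refine HomologicalComplex.cycleClass_ne_zero (K := singularC X) (sphereChain s) (sphereChain_d s)
    (labelHom l) (d_labelHom hl) ?_ ?_
  · intro h
    rw [sphereChain, sum_ι_labelHom] at h
    have h1 := congrArg ULift.down (ConcreteCategory.congr_hom h (ULift.up 1))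
    -- Off the boundary all barycentric coordinates are nonzero, so the arbitrary label `0`
    -- satisfies Sperner's condition there.
    let l' : stdSimplex ℝ (Fin (n + 2)) → Fin (n + 2) := fun x =>
      if hx : ∃ i, x i = 0 then l (s ⟨x, hx⟩) else 0
    have hl' : ∀ x : stdSimplex ℝ (Fin (n + 2)), x (l' x) ≠ 0 := by
      intro x
      by_cases hx : ∃ i, x i = 0
      · simpa only [l', dif_pos hx] using hs ⟨x, hx⟩
      · exact fun h => hx ⟨_, h⟩
    have h2 : ∑ i : Fin (n + 2), (-1 : ℤ) ^ (i : ℕ) •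
        labelGerm l (simplexOf (s.comp (simplexBoundary.face i))) =
        Filter.Germ.ofFun fun _ => 1 := by
      refine (sum_labelGerm_eq _ l' fun i => ?_).trans ?_
      · rw [simplexMap_simplexOf]
        funext y
        have hy : ∃ j, (stdSimplex.map i.succAbove y) j = 0 := (simplexBoundary.face i y).2
        change l (s ⟨_, hy⟩) = l' _
        simp only [l', dif_pos hy]
      · congr 1
        funext K
        exact stdSimplex.labelDet_push_subdivision _ K l' hl'
    rw [h2] at h1
    have h3 : (1 : ℤ) • (Filter.Germ.ofFun (l := (Filter.atTop : Filter ℕ)) fun _ => (1 : ℤ)) =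
      0 := h1
    rw [one_smul] at h3
    obtain ⟨K, hK⟩ := (Filter.Germ.coe_eq.1 h3).exists
    exact one_ne_zero hK
  · refine ModuleCat.hom_ext (LinearMap.ext fun a => ?_)
    have ha : a = a.down • (ULift.up 1 : intModule) := by
      apply ULift.down_injective
      simp
    rw [ha]
    exact ((map_zsmul (sphereClass s).hom _ _).trans (congrArg (a.down • ·) h0)).trans
      (zsmul_zero _)

end FundamentalClass

/-! ### Local homeomorphisms are essentially open -/

theorem inducesNonconstant_of_label {X Y : Type*} [TopologicalSpace X] [TopologicalSpace Y]
    {n : ℕ} (f : C(X, Y)) (s : C(simplexBoundary n, X)) {l : Y → Fin (n + 2)}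
    (hl : ∀ y, ∃ a, ∀ᶠ z in 𝓝 y, l z ≠ a)
    (hs : ∀ x : simplexBoundary n, x.1 (l (f (s x))) ≠ 0) : InducesNonconstant n f := by
  let s' : C(simplexBoundary n, TopCat.of (ULift X)) :=
    ⟨fun x => ULift.up (s x), continuous_uliftUp.comp s.continuous⟩
  refine ⟨⟨sphereClass s' (ULift.up 1), sphereClass_mem_reducedH _ _⟩, 0, ?_⟩
  rw [map_zero]
  intro h
  have h1 : singularHMap n (liftedHom f) (sphereClass s' (ULift.up 1)) = 0 :=
    congrArg Subtype.val h
  rw [singularHMap_sphereClass] at h1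
  refine sphereClass_ne_zero (l := fun y : ULift Y => l y.down) (fun y => ?_) _ ?_ h1
  · obtain ⟨a, ha⟩ := hl y.down
    exact ⟨a, continuous_uliftDown.continuousAt.eventually ha⟩
  · exact hs

/-- The coordinates of a point of the standard simplex relative to the first one. -/
noncomputable def simplexVector {n : ℕ} (x : stdSimplex ℝ (Fin (n + 2))) :
    EuclideanSpace ℝ (Fin (n + 1)) :=
  WithLp.toLp 2 fun i => x i.succ - x 0

theorem continuous_simplexVector {n : ℕ} : Continuous (simplexVector (n := n)) := by
  refine (PiLp.continuous_toLp 2 _).comp (continuous_pi fun i => ?_)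
  exact ((continuous_apply _).comp continuous_subtype_val).sub
    ((continuous_apply _).comp continuous_subtype_val)

theorem exists_coord_lt_of_ne_zero {n : ℕ} {v : EuclideanSpace ℝ (Fin (n + 1))} (hv : v ≠ 0) :
    ∃ a b, (Fin.cons 0 v.ofLp : Fin (n + 2) → ℝ) a < (Fin.cons 0 v.ofLp : Fin (n + 2) → ℝ) b := by
  by_contra! h
  apply hv
  ext i
  have h1 := h 0 i.succ
  have h2 := h i.succ 0
  simp only [Fin.cons_zero, Fin.cons_succ] at h1 h2
  exact le_antisymm h1 h2

/-- Label `y` by the index of a largest entry of `(0, g y)`. As `g y ≠ 0`, two entries differ, and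
the index of the smaller one is missing near `y`. On the image of the simplex boundary the label
picks a largest barycentric coordinate, which is positive. -/
theorem inducesNonconstant_of_vector {X Y : Type*} [TopologicalSpace X] [TopologicalSpace Y]
    {n : ℕ} (f : C(X, Y)) (s : C(simplexBoundary n, X))
    (g : C(Y, EuclideanSpace ℝ (Fin (n + 1)))) (hg : ∀ y, g y ≠ 0)
    (hs : ∀ x : simplexBoundary n, ∃ c > 0, g (f (s x)) = (c : ℝ) • simplexVector x.1) :
    InducesNonconstant n f := by
  have hmax : ∀ y, ∃ a : Fin (n + 2), ∀ b,
      (Fin.cons 0 (g y).ofLp : Fin (n + 2) → ℝ) b ≤ (Fin.cons 0 (g y).ofLp : Fin (n + 2) → ℝ) a :=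
    fun y => Finite.exists_max _
  choose l hl using hmax
  have hcont : ∀ a : Fin (n + 2), Continuous fun y => (Fin.cons 0 (g y).ofLp : Fin (n + 2) → ℝ) a := by
    intro a
    refine Fin.cases ?_ (fun i => ?_) a
    · simpa using continuous_const
    · simp only [Fin.cons_succ]
      fun_prop
  refine inducesNonconstant_of_label f s (l := l) (fun y => ?_) fun x => ?_
  · obtain ⟨a, b, hab⟩ := exists_coord_lt_of_ne_zero (hg y)
    refine ⟨a, ?_⟩
    filter_upwards [(hcont a).continuousAt.eventually_lt (hcont b).continuousAt hab] with z hz h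
    have := hl z b
    rw [h] at this
    exact absurd hz (not_lt.2 this)
  · obtain ⟨c, hc, hx⟩ := hs x
    have key : ∀ b, (Fin.cons 0 (g (f (s x))).ofLp : Fin (n + 2) → ℝ) b = c * (x.1 b - x.1 0) := by
      intro b
      rw [hx]
      refine Fin.cases ?_ (fun i => ?_) b <;> simp [simplexVector]
    intro h0
    have h1 : ∀ b, x.1 b ≤ 0 := by
      intro b
      have := hl (f (s x)) b
      rw [key, key, h0] at this
      linarith [le_of_mul_le_mul_left this hc]
    have h2 : ∑ b, x.1 b = 1 := stdSimplex.sum_eq_one _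
    have h3 : ∑ b, x.1 b ≤ 0 := Finset.sum_nonpos fun b _ => h1 b
    linarith

theorem simplexVector_ne_zero {n : ℕ} (x : simplexBoundary n) : simplexVector x.1 ≠ 0 := by
  intro h
  obtain ⟨i, hi⟩ := x.2
  have h0 : ∀ b, x.1 b = x.1 0 := by
    intro b
    refine Fin.cases rfl (fun j => ?_) b
    have := congrArg (fun v : EuclideanSpace ℝ (Fin (n + 1)) => v j) h
    simpa [simplexVector, sub_eq_zero] using this
  have h1 : ∀ b, x.1 b = 0 := fun b => by rw [h0 b, ← h0 i, hi]
  have h2 : ∑ b, x.1 b = 1 := stdSimplex.sum_eq_one _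
  simp [h1] at h2

/-- A subset of a subtype is homeomorphic to the corresponding subset of the ambient space. -/
def Homeomorph.preimageVal {X : Type*} [TopologicalSpace X] {Ω S : Set X} (h : S ⊆ Ω) :
    ((↑) ⁻¹' S : Set Ω) ≃ₜ S where
  toFun x := ⟨x.1.1, x.2⟩
  invFun x := ⟨⟨x.1, h x.2⟩, x.2⟩
  left_inv _ := rfl
  right_inv _ := rfl
  continuous_toFun := by fun_prop
  continuous_invFun := by fun_prop

section

variable {E : Type*} [NormedAddCommGroup E] [NormedSpace ℝ E]

/-- Dilation of the unit ball. -/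
noncomputable def Homeomorph.ballUnitBall (c : E) {r : ℝ} (hr : 0 < r) :
    Metric.ball c r ≃ₜ Metric.ball (0 : E) 1 :=
  (((Homeomorph.smulOfNeZero r hr.ne').trans (Homeomorph.addLeft c)).subtype fun x => by
    simp [norm_smul, abs_of_pos hr, hr]).symm

/-- Dilation of the unit sphere. -/
noncomputable def Homeomorph.sphereUnitSphere (c : E) {r : ℝ} (hr : 0 < r) :
    Metric.sphere c r ≃ₜ Metric.sphere (0 : E) 1 :=
  (((Homeomorph.smulOfNeZero r hr.ne').trans (Homeomorph.addLeft c)).subtype fun x => by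
    simp [norm_smul, abs_of_pos hr, hr.ne']).symm

end

/-- Take `U` the ball of half the radius of a ball in the source, so that its frontier stays inside,
and `V` the image of the large ball. The vector `e.symm y - c` is nonzero on the punctured `V` and
recovers the direction of a point of the sphere. -/
theorem essentiallyOpenAt_of_openPartialHomeomorph {n : ℕ} {Y : Type*} [TopologicalSpace Y]
    (e : OpenPartialHomeomorph (EuclideanSpace ℝ (Fin (n + 1))) Y)
    {Ω : Set (EuclideanSpace ℝ (Fin (n + 1)))} (hΩ : IsOpen Ω) (f : C(Ω, Y))
    (hf : ∀ x : Ω, (x : EuclideanSpace ℝ (Fin (n + 1))) ∈ e.source → f x = e x)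
    (p : Ω) (hp : (p : EuclideanSpace ℝ (Fin (n + 1))) ∈ e.source) :
    ∃ U : Set Ω, EssentiallyOpenAt (n + 1) f p U := by
  obtain ⟨R, hR, hball⟩ := Metric.isOpen_iff.1 (hΩ.inter e.open_source) p.1 ⟨p.2, hp⟩
  set c : EuclideanSpace ℝ (Fin (n + 1)) := p.1 with hc
  have hr : 0 < R / 2 := by positivity
  have hrR : R / 2 < R := by linarith
  have hbΩ : Metric.ball c (R / 2) ⊆ Ω := fun x hx => (hball (Metric.ball_subset_ball hrR.le hx)).1
  have hsR : Metric.sphere c (R / 2) ⊆ Metric.ball c R := fun x hx => by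
    rw [Metric.mem_ball, Metric.mem_sphere.1 hx]; exact hrR
  have hsΩ : Metric.sphere c (R / 2) ⊆ Ω := fun x hx => (hball (hsR hx)).1
  have hfr : frontier ((↑) ⁻¹' Metric.ball c (R / 2) : Set Ω) =
      (↑) ⁻¹' Metric.sphere c (R / 2) := by
    rw [← hΩ.isOpenMap_subtype_val.preimage_frontier_eq_frontier_preimage continuous_subtype_val,
      frontier_ball _ hr.ne']
  have hRs : Metric.ball c R ⊆ e.source := fun x hx => (hball hx).2
  have hcR : c ∈ Metric.ball c R := Metric.mem_ball_self hR
  have hfp : f p = e c := hf p hp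
  refine ⟨(↑) ⁻¹' Metric.ball c (R / 2), ?_, ⟨(Homeomorph.preimageVal hbΩ).trans
    (Homeomorph.ballUnitBall c hr)⟩, ?_, e '' Metric.ball c R, ?_,
    ⟨(e.homeomorphOfImageSubsetSource hRs rfl).symm.trans (Homeomorph.ballUnitBall c hR)⟩, ?_, ?_⟩
  · exact continuous_subtype_val.continuousAt.preimage_mem_nhds (Metric.ball_mem_nhds _ hr)
  · rw [hfr]
    exact ⟨(Homeomorph.preimageVal hsΩ).trans (Homeomorph.sphereUnitSphere c hr)⟩
  · rw [hfp]
    exact (e.isOpen_image_of_subset_source Metric.isOpen_ball hRs).mem_nhds (mem_image_of_mem _ hcR)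
  · rw [hfr]
    intro x hx
    have hxR := hsR hx
    rw [hf x (hRs hxR), hfp]
    refine ⟨mem_image_of_mem _ hxR, fun h => ?_⟩
    have hxc : (x : EuclideanSpace ℝ (Fin (n + 1))) = c := e.injOn (hRs hxR) hp h
    have : dist (x : EuclideanSpace ℝ (Fin (n + 1))) c = R / 2 := hx
    rw [hxc, dist_self] at this
    exact hr.ne this
  · have hV : ∀ y ∈ e '' Metric.ball c R, y ∈ e.target := by
      rintro _ ⟨x, hx, rfl⟩
      exact e.map_source (hRs hx)
    have hmem : ∀ x : simplexBoundary n, c + (R / 2 / ‖simplexVector x.1‖) • simplexVector x.1 ∈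
        Metric.sphere c (R / 2) := by
      intro x
      have := norm_pos_iff.2 (simplexVector_ne_zero x)
      rw [mem_sphere_iff_norm, add_sub_cancel_left, norm_smul, norm_div, norm_norm,
        Real.norm_of_nonneg hr.le]
      field_simp
    have hsymm : ∀ v (hv : v ∈ Metric.sphere c (R / 2)), e.symm (f ⟨v, hsΩ hv⟩) = v := by
      intro v hv
      rw [hf ⟨v, hsΩ hv⟩ (hRs (hsR hv)), e.left_inv (hRs (hsR hv))]
    have hv : Continuous fun x : simplexBoundary n => simplexVector x.1 :=
      continuous_simplexVector.comp continuous_subtype_val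
    let s : C(simplexBoundary n, frontier ((↑) ⁻¹' Metric.ball c (R / 2) : Set Ω)) :=
      ⟨fun x => ⟨⟨_, hsΩ (hmem x)⟩, hfr ▸ hmem x⟩, by
        refine Continuous.subtype_mk (Continuous.subtype_mk ?_ _) _
        exact continuous_const.add ((continuous_const.div hv.norm fun x =>
          (norm_pos_iff.2 (simplexVector_ne_zero x)).ne').smul hv)⟩
    refine inducesNonconstant_of_vector _ s ⟨fun y => e.symm y.1 - c, ?_⟩ (fun y h => ?_) fun x => ?_
    · refine Continuous.sub ?_ continuous_const
      exact e.continuousOn_symm.comp_continuous continuous_subtype_val fun y => hV _ y.2.1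
    · apply y.2.2
      exact ((e.right_inv (hV _ y.2.1)).symm.trans (congrArg e (sub_eq_zero.1 h))).trans hfp.symm
    · refine ⟨_, div_pos hr (norm_pos_iff.2 (simplexVector_ne_zero x)), ?_⟩
      exact (congrArg (· - c) (hsymm _ (hmem x))).trans (add_sub_cancel_left _ _)

/-! ### Local flows of smooth vector fields -/

section Superposition

universe u

variable {K : Type*} [TopologicalSpace K] [CompactSpace K]

/-- The pointwise application of a continuous family of linear maps. -/
noncomputable def ContinuousMap.pointwiseCLM (K : Type*) [TopologicalSpace K] [CompactSpace K]
    (E F : Type*) [NormedAddCommGroup E] [NormedSpace ℝ E]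
    [NormedAddCommGroup F] [NormedSpace ℝ F] : C(K, E →L[ℝ] F) →L[ℝ] C(K, E) →L[ℝ] C(K, F) :=
  LinearMap.mkContinuous₂ (LinearMap.mk₂ ℝ
    (fun (A : C(K, E →L[ℝ] F)) (η : C(K, E)) =>
      (⟨fun s => A s (η s), A.continuous.clm_apply η.continuous⟩ : C(K, F)))
    (fun _ _ _ => by ext; simp) (fun _ _ _ => by ext; simp) (fun _ _ _ => by ext; simp)
    (fun _ _ _ => by ext; simp)) 1 fun A η => by
      rw [one_mul, ContinuousMap.norm_le _ (by positivity)]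
      intro s
      exact ((A s).le_opNorm _).trans
        (mul_le_mul (A.norm_coe_le_norm s) (η.norm_coe_le_norm s) (by positivity) (by positivity))

/-- Compactness of the range of `γ` makes the continuity of `v'` uniform near it, and the mean value
inequality then bounds the remainder uniformly in the parameter. -/
theorem ContinuousMap.hasFDerivAt_postcomp {E F : Type*} [NormedAddCommGroup E] [NormedSpace ℝ E]
    [NormedAddCommGroup F] [NormedSpace ℝ F] (v : C(E, F)) (v' : C(E, E →L[ℝ] F))
    (h : ∀ x, HasFDerivAt v (v' x) x) (γ : C(K, E)) :
    HasFDerivAt (fun η : C(K, E) => v.comp η)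
      (ContinuousMap.pointwiseCLM K E F (v'.comp γ)) γ := by
  rw [hasFDerivAt_iff_isLittleO, Asymptotics.isLittleO_iff]
  intro ε hε
  have hU := (isCompact_range γ.continuous).uniformContinuousAt_of_continuousAt v'
    (fun a _ => v'.continuous.continuousAt) (Metric.dist_mem_uniformity hε)
  obtain ⟨δ, hδ, hU⟩ := Metric.mem_uniformity_dist.1 hU
  filter_upwards [Metric.ball_mem_nhds γ hδ] with η hη
  rw [ContinuousMap.norm_le _ (by positivity)]
  intro s
  have hs : dist (γ s) (η s) < δ := by
    rw [dist_comm]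
    exact (ContinuousMap.dist_apply_le_dist s).trans_lt hη
  have hm := (convex_ball (γ s) δ).norm_image_sub_le_of_norm_hasFDerivWithin_le' (f := v)
    (f' := v') (φ := v' (γ s)) (C := ε) (x := γ s) (y := η s)
    (fun x _ => (h x).hasFDerivWithinAt) (fun x hx => by
      have : dist (v' (γ s)) (v' x) < ε :=
        hU (by rwa [dist_comm]) (mem_range_self s)
      rw [← dist_eq_norm, dist_comm]
      exact this.le) (Metric.mem_ball_self hδ) (by rwa [Metric.mem_ball, dist_comm])
  refine hm.trans (mul_le_mul_of_nonneg_left ?_ hε.le)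
  exact (η - γ).norm_coe_le_norm s

/-- The derivative is again a composition operator, with `v'` in place of `v`, followed by a
continuous linear map. The induction replaces `F` by `E →L[ℝ] F`, hence the common universe. -/
theorem ContinuousMap.contDiff_postcomp {E : Type u} [NormedAddCommGroup E] [NormedSpace ℝ E]
    (n : ℕ) {F : Type u} [NormedAddCommGroup F] [NormedSpace ℝ F] (v : C(E, F))
    (hv : ContDiff ℝ n v) : ContDiff ℝ n fun η : C(K, E) => v.comp η := by
  induction n generalizing F with
  | zero =>
    exact contDiff_zero.2 (ContinuousMap.continuous_postcomp v)
  | succ n ih =>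
    have hv' : ContDiff ℝ ((n : ℕ∞ω) + 1) v := by exact_mod_cast hv
    obtain ⟨h1, -, h2⟩ := contDiff_succ_iff_fderiv.1 hv'
    let v' : C(E, E →L[ℝ] F) := ⟨fderiv ℝ v, h2.continuous⟩
    have hd := ContinuousMap.hasFDerivAt_postcomp (K := K) v v' fun x => (h1 x).hasFDerivAt
    have : ContDiff ℝ ((n : ℕ∞ω) + 1) fun η : C(K, E) => v.comp η := by
      refine contDiff_succ_iff_fderiv.2 ⟨fun γ => (hd γ).differentiableAt, by simp, ?_⟩
      rw [show fderiv ℝ (fun η : C(K, E) => v.comp η) =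
        fun γ => ContinuousMap.pointwiseCLM K E F (v'.comp γ) from funext fun γ => (hd γ).fderiv]
      exact (ContinuousMap.pointwiseCLM K E F).contDiff.comp (ih v' h2)
    exact_mod_cast this

end Superposition

/-! ### The integral operator on curves. -/

section Primitive

variable {E : Type*} [NormedAddCommGroup E] [NormedSpace ℝ E] [CompleteSpace E]

/-- The interval on which curves are parametrized. -/
abbrev timeInterval : Type := Icc (-2 : ℝ) 2

/-- The extension of a curve to the real line. -/
noncomputable def extendCurve {E : Type*} [NormedAddCommGroup E] (η : C(timeInterval, E)) (u : ℝ) : E :=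
  η (projIcc (-2) 2 (by norm_num) u)

theorem continuous_extendCurve {E : Type*} [NormedAddCommGroup E] (η : C(timeInterval, E)) : Continuous (extendCurve η) :=
  η.continuous.comp continuous_projIcc

/-- The primitive that vanishes at `0`. -/
noncomputable def primitiveCLM (E : Type*) [NormedAddCommGroup E] [NormedSpace ℝ E]
    [CompleteSpace E] : C(timeInterval, E) →L[ℝ] C(timeInterval, E) :=
  LinearMap.mkContinuous
    { toFun := fun η => ⟨fun s => ∫ u in (0 : ℝ)..s, extendCurve η u,
        (intervalIntegral.continuous_primitive
          (fun a b => (continuous_extendCurve η).intervalIntegrable a b) 0).comp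
          continuous_subtype_val⟩
      map_add' := fun η ζ => by
        ext s
        exact intervalIntegral.integral_add ((continuous_extendCurve η).intervalIntegrable _ _)
          ((continuous_extendCurve ζ).intervalIntegrable _ _)
      map_smul' := fun c η => by
        ext s
        exact intervalIntegral.integral_smul c _ } 2 fun η => by
    rw [ContinuousMap.norm_le _ (by positivity)]
    intro s
    refine (intervalIntegral.norm_integral_le_of_norm_le_const (C := ‖η‖)
      fun u _ => η.norm_coe_le_norm _).trans ?_
    rw [sub_zero, mul_comm]
    exact mul_le_mul_of_nonneg_right (abs_le.2 s.2) (norm_nonneg _)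

theorem primitiveCLM_apply (η : C(timeInterval, E)) (s : timeInterval) :
    primitiveCLM E η s = ∫ u in (0 : ℝ)..s, extendCurve η u := rfl

theorem hasDerivAt_primitive (η : C(timeInterval, E)) (s : ℝ) :
    HasDerivAt (fun s : ℝ => ∫ u in (0 : ℝ)..s, extendCurve η u) (extendCurve η s) s :=
  intervalIntegral.integral_hasDerivAt_right
    ((continuous_extendCurve η).intervalIntegrable _ _)
    ((continuous_extendCurve η).stronglyMeasurableAtFilter _ _)
    (continuous_extendCurve η).continuousAt

/-- The inclusion of the constant curves. -/
noncomputable def constCurveCLM (E : Type*) [NormedAddCommGroup E] [NormedSpace ℝ E] :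
    E →L[ℝ] C(timeInterval, E) where
  toFun x := ContinuousMap.const _ x
  map_add' _ _ := rfl
  map_smul' _ _ := rfl
  cont := ContinuousMap.continuous_const'

end Primitive

/-! ### Local flows by the inverse function theorem on a space of curves. -/

section Flow

variable {E : Type*} [NormedAddCommGroup E] [NormedSpace ℝ E]

/-- The flow of `X` leads from `p` to `q` in time `t` along a curve in `O`. -/
def FlowsIn (O : Set E) (X : E → E) (t : ℝ) (p q : E) : Prop :=
  ∃ (γ : ℝ → E) (a b : ℝ), (0 : ℝ) ∈ Ioo a b ∧ t ∈ Ioo a b ∧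
    (∀ s ∈ Ioo a b, γ s ∈ O ∧ HasDerivAt γ (X (γ s)) s) ∧ γ 0 = p ∧ γ t = q

theorem FlowsIn.mono {O O' : Set E} {X : E → E} {t : ℝ} {p q : E} (h : FlowsIn O X t p q)
    (hO : O ⊆ O') : FlowsIn O' X t p q := by
  obtain ⟨γ, a, b, h0, ht, hd, hp, hq⟩ := h
  exact ⟨γ, a, b, h0, ht, fun s hs => ⟨hO (hd s hs).1, (hd s hs).2⟩, hp, hq⟩

/-- The derivative of `curveEquation` at a constant curve and time `0`. -/
noncomputable def curveEquationDeriv (w : C(timeInterval, E)) :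
    (ℝ × E × C(timeInterval, E)) ≃L[ℝ] (ℝ × E × C(timeInterval, E)) :=
  ContinuousLinearEquiv.equivOfInverse
    ((ContinuousLinearMap.fst ℝ ℝ (E × C(timeInterval, E))).prod
      (((ContinuousLinearMap.fst ℝ E C(timeInterval, E)).comp
        (ContinuousLinearMap.snd ℝ ℝ (E × C(timeInterval, E)))).prod
      ((ContinuousLinearMap.snd ℝ E C(timeInterval, E)).comp
        (ContinuousLinearMap.snd ℝ ℝ (E × C(timeInterval, E))) -
      (constCurveCLM E).comp ((ContinuousLinearMap.fst ℝ E C(timeInterval, E)).comp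
        (ContinuousLinearMap.snd ℝ ℝ (E × C(timeInterval, E)))) -
      (ContinuousLinearMap.fst ℝ ℝ (E × C(timeInterval, E))).smulRight w)))
    ((ContinuousLinearMap.fst ℝ ℝ (E × C(timeInterval, E))).prod
      (((ContinuousLinearMap.fst ℝ E C(timeInterval, E)).comp
        (ContinuousLinearMap.snd ℝ ℝ (E × C(timeInterval, E)))).prod
      ((ContinuousLinearMap.snd ℝ E C(timeInterval, E)).comp
        (ContinuousLinearMap.snd ℝ ℝ (E × C(timeInterval, E))) +
      (constCurveCLM E).comp ((ContinuousLinearMap.fst ℝ E C(timeInterval, E)).comp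
        (ContinuousLinearMap.snd ℝ ℝ (E × C(timeInterval, E)))) +
      (ContinuousLinearMap.fst ℝ ℝ (E × C(timeInterval, E))).smulRight w)))
    (fun z => by ext <;> simp [sub_sub, add_assoc])
    (fun z => by ext <;> simp [sub_sub, add_assoc])

theorem curveEquationDeriv_symm_apply (w : C(timeInterval, E)) (z : ℝ × E × C(timeInterval, E)) :
    (curveEquationDeriv w).symm z = (z.1, z.2.1, z.2.2 + constCurveCLM E z.2.1 + z.1 • w) := rfl

variable [CompleteSpace E]

/-- The map whose zeros are the rescaled integral curves of `v`. -/
noncomputable def curveEquation (v : C(E, E)) (z : ℝ × E × C(timeInterval, E)) :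
    ℝ × E × C(timeInterval, E) :=
  (z.1, z.2.1, z.2.2 - constCurveCLM E z.2.1 - z.1 • primitiveCLM E (v.comp z.2.2))

theorem contDiff_curveEquation (n : ℕ) (v : C(E, E)) (hv : ContDiff ℝ n v) :
    ContDiff ℝ n (curveEquation v) := by
  have h := (ContinuousMap.contDiff_postcomp (K := timeInterval) n v hv).comp
    (contDiff_snd.comp contDiff_snd : ContDiff ℝ n fun z : ℝ × E × C(timeInterval, E) => z.2.2)
  refine contDiff_fst.prodMk ((contDiff_fst.comp contDiff_snd).prodMk ?_)
  refine ((contDiff_snd.comp contDiff_snd).sub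
    ((constCurveCLM E).contDiff.comp (contDiff_fst.comp contDiff_snd))).sub
    (contDiff_fst.smul ((primitiveCLM E).contDiff.comp h))

/-- At time `0` the factor `z.1` kills the derivative of the integral term, so `v'` does not appear
and the differential is triangular with an explicit inverse. -/
theorem hasFDerivAt_curveEquation (v : C(E, E)) (hv : ContDiff ℝ 1 v) (p : E) :
    HasFDerivAt (curveEquation v)
      (curveEquationDeriv (primitiveCLM E (v.comp (constCurveCLM E p))) :
        (ℝ × E × C(timeInterval, E)) →L[ℝ] _) (0, p, constCurveCLM E p) := by
  have h : Differentiable ℝ fun z : ℝ × E × C(timeInterval, E) => primitiveCLM E (v.comp z.2.2) := by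
    have := (ContinuousMap.contDiff_postcomp (K := timeInterval) 1 v hv).comp
      (contDiff_snd.comp contDiff_snd :
        ContDiff ℝ 1 fun z : ℝ × E × C(timeInterval, E) => z.2.2)
    exact ((primitiveCLM E).contDiff.comp this).differentiable (by simp)
  have h3 := (hasFDerivAt_fst (𝕜 := ℝ) (p := ((0, p, constCurveCLM E p) :
    ℝ × E × C(timeInterval, E)))).smul (h (0, p, constCurveCLM E p)).hasFDerivAt
  have h2 : HasFDerivAt (fun z : ℝ × E × C(timeInterval, E) => z.2.2)
      ((ContinuousLinearMap.snd ℝ E C(timeInterval, E)).comp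
        (ContinuousLinearMap.snd ℝ ℝ (E × C(timeInterval, E)))) (0, p, constCurveCLM E p) :=
    ((ContinuousLinearMap.snd ℝ E C(timeInterval, E)).comp
        (ContinuousLinearMap.snd ℝ ℝ (E × C(timeInterval, E)))).hasFDerivAt
  have h1 : HasFDerivAt (fun z : ℝ × E × C(timeInterval, E) => z.2.1)
      ((ContinuousLinearMap.fst ℝ E C(timeInterval, E)).comp
        (ContinuousLinearMap.snd ℝ ℝ (E × C(timeInterval, E)))) (0, p, constCurveCLM E p) :=
    ((ContinuousLinearMap.fst ℝ E C(timeInterval, E)).comp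
        (ContinuousLinearMap.snd ℝ ℝ (E × C(timeInterval, E)))).hasFDerivAt
  refine (hasFDerivAt_fst.prodMk (h1.prodMk
    ((h2.sub ((constCurveCLM E).hasFDerivAt.comp _ h1)).sub h3))).congr_fderiv ?_
  ext z <;> simp [curveEquationDeriv]

/-- `Γ` is the curve component of the local inverse of `curveEquation`, restricted to targets `(τ,
x, 0)`. -/
theorem exists_curve_family (v : C(E, E)) (hv : ContDiff ℝ 2 v) (p : E) :
    ∃ Γ : ℝ × E → C(timeInterval, E), ContDiffAt ℝ 2 Γ (0, p) ∧ Γ (0, p) = constCurveCLM E p ∧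
      (∃ Γ' : (ℝ × E) →L[ℝ] C(timeInterval, E), HasFDerivAt Γ Γ' (0, p) ∧
        ∀ τ ξ, Γ' (τ, ξ) = constCurveCLM E ξ +
          τ • primitiveCLM E (v.comp (constCurveCLM E p))) ∧
      ∀ᶠ z in 𝓝 (0, p), Γ z = constCurveCLM E z.2 + z.1 • primitiveCLM E (v.comp (Γ z)) := by
  set a : ℝ × E × C(timeInterval, E) := (0, p, constCurveCLM E p) with ha
  have hc : ContDiffAt ℝ 2 (curveEquation v) a := (contDiff_curveEquation 2 v hv).contDiffAt
  have hd := hasFDerivAt_curveEquation v (hv.of_le (by norm_num)) p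
  have hs := hc.hasStrictFDerivAt' hd (by norm_num)
  have h2 : (2 : ℕ∞ω) ≠ 0 := by norm_num
  have hGa : curveEquation v a = (0, p, 0) := by simp [curveEquation, ha]
  set H := hs.localInverse _ _ _ with hH
  have hHc : ContDiffAt ℝ 2 H (0, p, 0) := by
    rw [← hGa]
    exact hc.to_localInverse hd h2
  have hHd : HasFDerivAt H _ (0, p, 0) := hGa ▸ hs.to_localInverse.hasFDerivAt
  have hHa : H (0, p, 0) = a := by
    rw [← hGa]
    exact hs.localInverse_apply_image
  have hinv : ∀ᶠ z in 𝓝 (0, p, 0), curveEquation v (H z) = z :=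
    hGa ▸ hs.eventually_right_inverse
  let ι : ℝ × E →L[ℝ] ℝ × E × C(timeInterval, E) :=
    (ContinuousLinearMap.fst ℝ ℝ E).prod ((ContinuousLinearMap.snd ℝ ℝ E).prod 0)
  let π : ℝ × E × C(timeInterval, E) →L[ℝ] C(timeInterval, E) :=
    (ContinuousLinearMap.snd ℝ E C(timeInterval, E)).comp
        (ContinuousLinearMap.snd ℝ ℝ (E × C(timeInterval, E)))
  have hι : ι (0, p) = (0, p, 0) := rfl
  refine ⟨fun z => π (H (ι z)), ?_, ?_, ⟨_, π.hasFDerivAt.comp _ (HasFDerivAt.comp _ hHd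
    ι.hasFDerivAt), ?_⟩, ?_⟩
  · exact π.contDiff.contDiffAt.comp _ (ContDiffAt.comp _ hHc ι.contDiff.contDiffAt)
  · change (H (0, p, 0)).2.2 = _
    rw [hHa]
  · intro τ ξ
    change ((curveEquationDeriv _).symm (τ, ξ, 0)).2.2 = _
    rw [curveEquationDeriv_symm_apply]
    simp
  · filter_upwards [ι.continuous.continuousAt.eventually hinv] with z hz
    have h1 : (H (ι z)).1 = z.1 := congrArg Prod.fst hz
    have h3 : (H (ι z)).2.1 = z.2 := congrArg (fun z => z.2.1) hz
    have h4 : (H (ι z)).2.2 - constCurveCLM E (H (ι z)).2.1 -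
      (H (ι z)).1 • primitiveCLM E (v.comp (H (ι z)).2.2) = 0 := congrArg (fun z => z.2.2) hz
    rw [h1, h3, sub_sub, sub_eq_zero] at h4
    exact h4

/-- Undo the rescaling by setting `γ s = η (s / τ)`. Parametrizing on `[-2, 2]` rather than `[0, 1]`
puts both `0` and `τ` in the interior of the time domain. -/
theorem hasDerivAt_of_curve_equation {v : C(E, E)} {x : E} {τ : ℝ} {η : C(timeInterval, E)}
    (h : η = constCurveCLM E x + τ • primitiveCLM E (v.comp η)) (hτ : τ ≠ 0) :
    ∃ γ : ℝ → E, γ 0 = x ∧ γ τ = η ⟨1, by norm_num⟩ ∧ ∀ s ∈ Ioo (-2 * |τ|) (2 * |τ|),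
      γ s ∈ range η ∧ HasDerivAt γ (v (γ s)) s := by
  set γ₀ : ℝ → E := fun s => x + τ • ∫ u in (0 : ℝ)..s, extendCurve (v.comp η) u with hγ₀
  have hη : ∀ s : timeInterval, η s = γ₀ s := fun s => DFunLike.congr_fun h s
  have hd : ∀ s, HasDerivAt γ₀ (τ • extendCurve (v.comp η) s) s := fun s =>
    ((hasDerivAt_primitive (v.comp η) s).const_smul τ).const_add x
  refine ⟨fun s => γ₀ (τ⁻¹ * s), by simp [hγ₀], ?_, fun s hs => ?_⟩
  · rw [hη]
    simp [hτ]
  · have hs' : τ⁻¹ * s ∈ Icc (-2 : ℝ) 2 := by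
      refine abs_le.1 ?_
      rw [abs_mul, abs_inv, inv_mul_le_iff₀ (abs_pos.2 hτ), mul_comm]
      exact abs_le.2 ⟨by linarith [hs.1], hs.2.le⟩
    refine ⟨⟨⟨_, hs'⟩, hη _⟩, ?_⟩
    have h1 := (hd (τ⁻¹ * s)).scomp s ((hasDerivAt_id s).const_mul τ⁻¹)
    have h2 : extendCurve (v.comp η) (τ⁻¹ * s) = v (γ₀ (τ⁻¹ * s)) := by
      rw [extendCurve, projIcc_of_mem _ hs', ContinuousMap.comp_apply, hη]
    rw [h2, smul_smul, mul_one, inv_mul_cancel₀ hτ, one_smul] at h1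
    exact h1

theorem exists_local_flow_of_eqOn (v : C(E, E)) (hv : ContDiff ℝ 2 v) {X : E → E} {p : E}
    {O : Set E} (hO : O ∈ 𝓝 p) (hX : EqOn X v O) :
    ∃ Φ : ℝ × E → E, ContDiffAt ℝ 2 Φ (0, p) ∧ Φ (0, p) = p ∧
      (∃ Φ' : (ℝ × E) →L[ℝ] E, HasFDerivAt Φ Φ' (0, p) ∧ ∀ τ ξ, Φ' (τ, ξ) = ξ + τ • X p) ∧
      ∀ᶠ z in 𝓝 (0, p), FlowsIn O X z.1 z.2 (Φ z) := by
  obtain ⟨Γ, hΓc, hΓ0, ⟨Γ', hΓd, hΓ'⟩, hΓe⟩ := exists_curve_family v hv p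
  let ev : C(timeInterval, E) →L[ℝ] E := ContinuousMap.evalCLM ℝ ⟨1, by norm_num⟩
  obtain ⟨ρ, hρ, hball⟩ := Metric.mem_nhds_iff.1 hO
  have hnear : ∀ᶠ z in 𝓝 (0, p), range (Γ z) ⊆ O := by
    filter_upwards [hΓc.continuousAt.eventually (Metric.ball_mem_nhds _ hρ)] with z hz
    rintro _ ⟨s, rfl⟩
    apply hball
    rw [hΓ0] at hz
    exact (ContinuousMap.dist_apply_le_dist (f := Γ z) (g := constCurveCLM E p) s).trans_lt hz
  refine ⟨fun z => ev (Γ z), ev.contDiff.contDiffAt.comp _ hΓc, ?_,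
    ⟨_, ev.hasFDerivAt.comp _ hΓd, fun τ ξ => ?_⟩, ?_⟩
  · exact congrArg ev hΓ0
  · change Γ' (τ, ξ) ⟨1, _⟩ = _
    have h1 : ∀ s, extendCurve (v.comp (constCurveCLM E p)) s = v p := fun s => rfl
    rw [hΓ', ContinuousMap.add_apply, ContinuousMap.smul_apply, primitiveCLM_apply]
    simp only [h1]
    rw [hX (mem_of_mem_nhds hO)]
    simp
    rfl
  · obtain ⟨r, hr, hgood⟩ := Metric.eventually_nhds_iff_ball.1 (hΓe.and hnear)
    filter_upwards [Metric.ball_mem_nhds _ hr] with z hz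
    obtain ⟨τ, x⟩ := z
    have key : ∀ τ, (τ, x) ∈ Metric.ball ((0 : ℝ), p) r → τ ≠ 0 → ∃ γ : ℝ → E, γ 0 = x ∧
        γ τ = ev (Γ (τ, x)) ∧
        ∀ s ∈ Ioo (-2 * |τ|) (2 * |τ|), γ s ∈ O ∧ HasDerivAt γ (X (γ s)) s := by
      intro τ hz hτ
      obtain ⟨he, hn⟩ := hgood _ hz
      obtain ⟨γ, h0, h1, h2⟩ := hasDerivAt_of_curve_equation he hτ
      refine ⟨γ, h0, h1, fun s hs => ?_⟩
      obtain ⟨h3, h4⟩ := h2 s hs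
      exact ⟨hn h3, by rwa [hX (hn h3)]⟩
    -- At time `0` the rescaled curve is constant and cannot be unscaled, so the required integral
    -- curve is borrowed from time `r / 2`.
    by_cases hτ : τ = 0
    · subst hτ
      have hx : dist x p < r := (le_max_right _ _).trans_lt hz
      obtain ⟨γ, h0, -, h2⟩ := key (r / 2) (by
        rw [Metric.mem_ball, Prod.dist_eq, max_lt_iff, Real.dist_eq, sub_zero,
          abs_of_pos (by positivity)]
        exact ⟨by linarith, hx⟩) (by positivity)
      have hpos : 0 < |r / 2| := by positivity
      refine ⟨γ, _, _, ⟨by linarith, by linarith⟩, ⟨by linarith, by linarith⟩, h2, h0, ?_⟩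
      change γ 0 = ev (Γ (0, x))
      rw [h0, (hgood _ hz).1]
      simp [ev]
      rfl
    · obtain ⟨γ, h0, h1, h2⟩ := key τ hz hτ
      have hpos : 0 < |τ| := abs_pos.2 hτ
      refine ⟨γ, _, _, ⟨by linarith, by linarith⟩, ⟨?_, ?_⟩, h2, h0, h1⟩
      · linarith [neg_abs_le τ]
      · linarith [le_abs_self τ]

end Flow

/-- A bump function cuts the field off, since the composition operator on curves requires a field
defined on all of `E`. -/
theorem exists_contDiff_eqOn_ball {E : Type*} [NormedAddCommGroup E] [NormedSpace ℝ E]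
    [FiniteDimensional ℝ E] {n : ℕ} {X : E → E} {O : Set E} (hO : IsOpen O)
    (hX : ContDiffOn ℝ n X O) {p : E} (hp : p ∈ O) :
    ∃ v : E → E, ContDiff ℝ n v ∧ ∃ ρ > 0, Metric.ball p ρ ⊆ O ∧ EqOn X v (Metric.ball p ρ) := by
  obtain ⟨r, hr, hball⟩ := Metric.nhds_basis_closedBall.mem_iff.1 (hO.mem_nhds hp)
  let f : ContDiffBump p := ⟨r / 2, r, by positivity, by linarith⟩
  refine ⟨fun y => f y • X y, contDiff_iff_contDiffAt.2 fun y => ?_, r / 2, by positivity,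
    fun y hy => hball (Metric.ball_subset_closedBall (Metric.ball_subset_ball (by linarith) hy)),
    fun y hy => ?_⟩
  · by_cases hy : y ∈ O
    · exact f.contDiff.contDiffAt.smul (hX.contDiffAt (hO.mem_nhds hy))
    · have : (Metric.closedBall p r)ᶜ ∈ 𝓝 y :=
        Metric.isClosed_closedBall.isOpen_compl.mem_nhds fun h => hy (hball h)
      refine contDiffAt_const (c := (0 : E)) |>.congr_of_eventuallyEq ?_
      filter_upwards [this] with z hz
      have hz' : r ≤ dist z p := (not_le.1 fun h => hz (Metric.mem_closedBall.2 h)).le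
      rw [f.zero_of_le_dist hz', zero_smul]
  · have := f.one_of_mem_closedBall (Metric.ball_subset_closedBall hy)
    simp only [this, one_smul]

/-- Existence of local flows with `C^2` dependence on time and the initial condition. -/
theorem exists_local_flow {E : Type*} [NormedAddCommGroup E] [NormedSpace ℝ E]
    [FiniteDimensional ℝ E] {X : E → E} {O : Set E} (hO : IsOpen O)
    (hX : ContDiffOn ℝ 2 X O) {p : E} (hp : p ∈ O) :
    ∃ Φ : ℝ × E → E, ContDiffAt ℝ 2 Φ (0, p) ∧ Φ (0, p) = p ∧
      (∃ Φ' : (ℝ × E) →L[ℝ] E, HasFDerivAt Φ Φ' (0, p) ∧ ∀ τ ξ, Φ' (τ, ξ) = ξ + τ • X p) ∧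
      ∀ᶠ z in 𝓝 (0, p), FlowsIn O X z.1 z.2 (Φ z) := by
  have : CompleteSpace E := FiniteDimensional.complete ℝ E
  obtain ⟨v, hv, ρ, hρ, hball, heq⟩ := exists_contDiff_eqOn_ball (n := 2) hO hX hp
  obtain ⟨Φ, h1, h2, h3, h4⟩ := exists_local_flow_of_eqOn ⟨v, hv.continuous⟩ hv
    (Metric.ball_mem_nhds p hρ) heq
  exact ⟨Φ, h1, h2, h3, h4.mono fun z hz => hz.mono hball⟩

/-! ### Immersions built from concatenated flows -/

section Immersion

variable {D E : Type*} [NormedAddCommGroup D] [NormedSpace ℝ D] [NormedAddCommGroup E]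
  [NormedSpace ℝ E] {φ : D → E} {t : D}

theorem fderiv_eq_of_tangent (hφ : ContDiffAt ℝ 2 φ t) {X : E → E}
    (hX : DifferentiableAt ℝ X (φ t)) {a : D → D} (ha : DifferentiableAt ℝ a t)
    (h : ∀ᶠ u in 𝓝 t, X (φ u) = fderiv ℝ φ u (a u)) (b : D) :
    fderiv ℝ X (φ t) (fderiv ℝ φ t b) =
      fderiv ℝ φ t (fderiv ℝ a t b) + fderiv ℝ (fderiv ℝ φ) t b (a t) := by
  have hd : DifferentiableAt ℝ (fderiv ℝ φ) t :=
    (hφ.fderiv_right (m := 1) (by norm_num)).differentiableAt (by norm_num)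
  have h1 := hX.hasFDerivAt.comp t (hφ.differentiableAt (by norm_num)).hasFDerivAt
  have h2 := (hd.hasFDerivAt.clm_apply ha.hasFDerivAt).congr_of_eventuallyEq
    (show X ∘ φ =ᶠ[𝓝 t] _ from h)
  have := DFunLike.congr_fun (h1.unique h2) b
  simpa using this

theorem ContinuousLinearMap.exists_leftInverse_of_finiteDimensional [FiniteDimensional ℝ E] {A : D →L[ℝ] E}
    (hA : Function.Injective A) :
    ∃ P : E →L[ℝ] D, P.comp A = ContinuousLinearMap.id ℝ D := by
  obtain ⟨g, hg⟩ := (A : D →ₗ[ℝ] E).exists_leftInverse_of_injective (LinearMap.ker_eq_bot.2 hA)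
  refine ⟨LinearMap.toContinuousLinearMap g, ?_⟩
  ext x
  exact LinearMap.congr_fun hg x

variable [FiniteDimensional ℝ D]

theorem ContinuousLinearMap.eventually_exists_equiv {P : E →L[ℝ] D} {A : D →L[ℝ] E}
    (hP : P.comp A = ContinuousLinearMap.id ℝ D) :
    ∀ᶠ B in 𝓝 A, ∃ e : D ≃L[ℝ] D, (e : D →L[ℝ] D) = P.comp B := by
  have : CompleteSpace D := FiniteDimensional.complete ℝ D
  have h : ContinuousAt (fun B : D →L[ℝ] E => P.comp B) A := by fun_prop
  refine h.eventually (p := fun C => ∃ e : D ≃L[ℝ] D, (e : D →L[ℝ] D) = C) ?_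
  change ∀ᶠ y in 𝓝 (P.comp A), _
  rw [hP]
  exact (ContinuousLinearEquiv.refl ℝ D).nhds

variable [FiniteDimensional ℝ E]

theorem ContinuousLinearMap.eventually_injective {A : D →L[ℝ] E} (hA : Function.Injective A) :
    ∀ᶠ B in 𝓝 A, Function.Injective (B : D →L[ℝ] E) := by
  obtain ⟨P, hP⟩ := exists_leftInverse_of_finiteDimensional hA
  filter_upwards [eventually_exists_equiv hP] with B hB
  obtain ⟨e, he⟩ := hB
  intro x y hxy
  apply e.injective
  have hx : ∀ x, e x = P (B x) := fun x => DFunLike.congr_fun he x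
  rw [hx, hx, hxy]

/-- With `P` a left inverse of the differential at `t`, the operator `P ∘ fderiv ℝ φ u` stays
invertible near `t`. Solving with its inverse gives coefficients that are differentiable at `t`. -/
theorem exists_tangent_coefficient (hφ : ContDiffAt ℝ 2 φ t)
    (hinj : Function.Injective (fderiv ℝ φ t)) {X : E → E} (hX : DifferentiableAt ℝ X (φ t))
    (htan : ∀ᶠ u in 𝓝 t, X (φ u) ∈ range (fderiv ℝ φ u)) :
    ∃ a : D → D, DifferentiableAt ℝ a t ∧ ∀ᶠ u in 𝓝 t, X (φ u) = fderiv ℝ φ u (a u) := by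
  have : CompleteSpace D := FiniteDimensional.complete ℝ D
  obtain ⟨P, hP⟩ := ContinuousLinearMap.exists_leftInverse_of_finiteDimensional hinj
  have hd : ContDiffAt ℝ 1 (fderiv ℝ φ) t := hφ.fderiv_right (by norm_num)
  have hA : DifferentiableAt ℝ (fun u => P.comp (fderiv ℝ φ u)) t :=
    (((ContinuousLinearMap.compL ℝ D E D) P).contDiff.contDiffAt.comp t hd).differentiableAt
      (by norm_num)
  have hinv : DifferentiableAt ℝ (fun u => (P.comp (fderiv ℝ φ u)).inverse) t := by
    have h : DifferentiableAt ℝ (ContinuousLinearMap.inverse : (D →L[ℝ] D) → D →L[ℝ] D)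
        (P.comp (fderiv ℝ φ t)) := by
      rw [hP]
      exact (contDiffAt_map_inverse (n := 1)
        (ContinuousLinearEquiv.refl ℝ D)).differentiableAt (by norm_num)
    exact h.comp t hA
  refine ⟨fun u => (P.comp (fderiv ℝ φ u)).inverse (P (X (φ u))), ?_, ?_⟩
  · have hφ' : DifferentiableAt ℝ φ t := hφ.differentiableAt (by norm_num)
    exact hinv.clm_apply (P.differentiableAt.comp t (hX.comp t hφ'))
  · filter_upwards [htan, hd.continuousAt.eventually
      (ContinuousLinearMap.eventually_exists_equiv hP)] with u ⟨c, hc⟩ ⟨e, he⟩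
    rw [← he, ContinuousLinearMap.inverse_equiv, ← hc]
    have : P (fderiv ℝ φ u c) = e c := (DFunLike.congr_fun he c).symm
    rw [this]
    simp

/-- Vector fields tangent to an immersion of class `C^2` have a tangent Lie bracket. -/
theorem lieBracket_mem_range_fderiv (hφ : ContDiffAt ℝ 2 φ t)
    (hinj : Function.Injective (fderiv ℝ φ t)) {X Y : E → E} (hX : DifferentiableAt ℝ X (φ t))
    (hY : DifferentiableAt ℝ Y (φ t))
    (hXt : ∀ᶠ u in 𝓝 t, X (φ u) ∈ range (fderiv ℝ φ u))
    (hYt : ∀ᶠ u in 𝓝 t, Y (φ u) ∈ range (fderiv ℝ φ u)) :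
    VectorField.lieBracket ℝ X Y (φ t) ∈ range (fderiv ℝ φ t) := by
  obtain ⟨a, ha, hXa⟩ := exists_tangent_coefficient hφ hinj hX hXt
  obtain ⟨b, hb, hYb⟩ := exists_tangent_coefficient hφ hinj hY hYt
  have hsymm : IsSymmSndFDerivAt ℝ φ t := hφ.isSymmSndFDerivAt (by simp)
  -- This is the bracket of the coefficient fields; the second derivatives of `φ` cancel by
  -- symmetry.
  refine ⟨fderiv ℝ b t (a t) - fderiv ℝ a t (b t), ?_⟩
  rw [VectorField.lieBracket, hXa.self_of_nhds, hYb.self_of_nhds,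
    fderiv_eq_of_tangent hφ hX ha hXa, fderiv_eq_of_tangent hφ hY hb hYb, hsymm.eq (a t) (b t),
    map_sub]
  abel

end Immersion

/-! ### Raising the dimension of an immersion one flow at a time. -/

section Concatenation

variable {E : Type*} [NormedAddCommGroup E] [NormedSpace ℝ E]

/-- Concatenated flows of vector fields, along curves in `O`. -/
def ChainFlowsIn (O : Set E) {k : ℕ} (X : Fin k → E → E) (t : Fin k → ℝ) (p q : E) : Prop :=
  ∃ c : Fin (k + 1) → E, c 0 = p ∧ c (Fin.last k) = q ∧
    ∀ i, FlowsIn O (X i) (t i) (c i.castSucc) (c i.succ)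

theorem ChainFlowsIn.snoc {O : Set E} {k : ℕ} {X : Fin k → E → E} {t : Fin (k + 1) → ℝ} {p q r : E}
    (h : ChainFlowsIn O X (Fin.init t) p q) {Y : E → E} (hY : FlowsIn O Y (t (Fin.last k)) q r) :
    ChainFlowsIn O (Fin.snoc X Y : Fin (k + 1) → E → E) t p r := by
  obtain ⟨c, h0, hl, h⟩ := h
  refine ⟨(Fin.snoc c r : Fin (k + 2) → E), ?_, by simp, fun i => ?_⟩
  · rw [← Fin.castSucc_zero, Fin.snoc_castSucc, h0]
  · refine Fin.lastCases ?_ (fun j => ?_) i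
    · rw [Fin.snoc_last, Fin.snoc_castSucc, Fin.succ_last, Fin.snoc_last, hl]
      exact hY
    · rw [Fin.snoc_castSucc, Fin.snoc_castSucc, Fin.succ_castSucc, Fin.snoc_castSucc]
      exact h j

/-- `φ` is an immersion of class `C^2` of `W` by concatenated flows in `O` starting at `p`, with
total time less than `T`. -/
structure IsFlowImmersion (O : Set E) (T : ℝ) (p : E) {k : ℕ} (X : Fin k → E → E)
    (W : Set (Fin k → ℝ)) (φ : (Fin k → ℝ) → E) : Prop where
  isOpen : IsOpen W
  nonempty : W.Nonempty
  contDiffAt : ∀ t ∈ W, ContDiffAt ℝ 2 φ t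
  injective : ∀ t ∈ W, Function.Injective (fderiv ℝ φ t)
  time_lt : ∀ t ∈ W, ∑ i, |t i| < T
  mem : ∀ t ∈ W, φ t ∈ O
  flows : ∀ t ∈ W, ChainFlowsIn O X t p (φ t)

theorem isFlowImmersion_zero {O : Set E} {T : ℝ} (hT : 0 < T) {p : E} (hp : p ∈ O)
    (X : Fin 0 → E → E) : IsFlowImmersion O T p X univ fun _ => p where
  isOpen := isOpen_univ
  nonempty := univ_nonempty
  contDiffAt _ _ := contDiffAt_const
  injective _ _ := Function.injective_of_subsingleton _
  time_lt _ _ := by simpa using hT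
  mem _ _ := hp
  flows _ _ := ⟨fun _ => p, rfl, rfl, fun i => i.elim0⟩

variable [FiniteDimensional ℝ E]

/-- An immersion can be extended along a flow that is transversal to it somewhere. -/
theorem IsFlowImmersion.exists_snoc {O : Set E} (hO : IsOpen O) {T : ℝ} {p : E} {k : ℕ}
    {X : Fin k → E → E} {W : Set (Fin k → ℝ)} {φ : (Fin k → ℝ) → E}
    (h : IsFlowImmersion O T p X W φ) {Y : E → E} (hY : ContDiffOn ℝ 2 Y O) {t : Fin k → ℝ}
    (ht : t ∈ W) (hYt : Y (φ t) ∉ range (fderiv ℝ φ t)) :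
    ∃ W' ψ, IsFlowImmersion O T p (Fin.snoc X Y : Fin (k + 1) → E → E) W' ψ := by
  obtain ⟨Φ, hΦc, hΦ0, ⟨Φ', hΦd, hΦ'⟩, hflow⟩ := exists_local_flow hO hY (h.mem t ht)
  let ini : (Fin (k + 1) → ℝ) →L[ℝ] (Fin k → ℝ) :=
    ContinuousLinearMap.pi fun i => ContinuousLinearMap.proj i.castSucc
  let las : (Fin (k + 1) → ℝ) →L[ℝ] ℝ := ContinuousLinearMap.proj (Fin.last k)
  -- At last time `0` the differential of the local flow is known explicitly, and the total time is
  -- still that of `t`, so the strict bound `T` survives nearby.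
  let u₀ : Fin (k + 1) → ℝ := Fin.snoc t 0
  have hini : ini u₀ = t := by
    funext i
    simp [ini, u₀]
  have hlas : las u₀ = 0 := by simp [las, u₀]
  let g : (Fin (k + 1) → ℝ) → ℝ × E := fun u => (las u, φ (ini u))
  have hg0 : g u₀ = (0, φ t) := by simp only [g, hini, hlas]
  have hgc : ContDiffAt ℝ 2 g u₀ := by
    refine las.contDiff.contDiffAt.prodMk (ContDiffAt.comp u₀ ?_ ini.contDiff.contDiffAt)
    rw [hini]
    exact h.contDiffAt t ht
  have hgd : HasFDerivAt g (las.prod ((fderiv ℝ φ t).comp ini)) u₀ := by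
    refine las.hasFDerivAt.prodMk (HasFDerivAt.comp u₀ ?_ ini.hasFDerivAt)
    rw [hini]
    exact ((h.contDiffAt t ht).differentiableAt (by norm_num)).hasFDerivAt
  have hc : ContDiffAt ℝ 2 (fun u => Φ (g u)) u₀ := by
    refine ContDiffAt.comp u₀ ?_ hgc
    rw [hg0]
    exact hΦc
  have hd : HasFDerivAt (fun u => Φ (g u)) (Φ'.comp (las.prod ((fderiv ℝ φ t).comp ini))) u₀ := by
    refine HasFDerivAt.comp u₀ ?_ hgd
    rw [hg0]
    exact hΦd
  have hinj : Function.Injective (fderiv ℝ (fun u => Φ (g u)) u₀) := by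
    rw [hd.fderiv, injective_iff_map_eq_zero]
    intro w hw
    have hw' : fderiv ℝ φ t (ini w) + las w • Y (φ t) = 0 := by
      rw [← hΦ']
      exact hw
    have hl : las w = 0 := by
      by_contra hl
      refine hYt ⟨-(las w)⁻¹ • ini w, ?_⟩
      rw [map_smul, eq_neg_of_add_eq_zero_left hw', smul_neg, neg_smul, neg_neg, smul_smul,
        inv_mul_cancel₀ hl, one_smul]
    rw [hl, zero_smul, add_zero] at hw'
    have hi : ini w = 0 := (injective_iff_map_eq_zero _).1 (h.injective t ht) _ hw'
    funext i
    refine Fin.lastCases hl (fun j => ?_) i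
    exact congrFun hi j
  have hcd : ContinuousAt (fderiv ℝ fun u => Φ (g u)) u₀ :=
    (hc.fderiv_right (m := 1) (by norm_num)).continuousAt
  have hW : ∀ᶠ u in 𝓝 u₀, ini u ∈ W :=
    ini.continuous.continuousAt.eventually (by rw [hini]; exact h.isOpen.mem_nhds ht)
  have hT : ∀ᶠ u in 𝓝 u₀, ∑ i, |u i| < T := by
    have hcont : Continuous fun u : Fin (k + 1) → ℝ => ∑ i, |u i| := by fun_prop
    refine hcont.continuousAt.eventually_lt continuousAt_const ?_
    simpa [Fin.sum_univ_castSucc, u₀] using h.time_lt t ht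
  have hfl : ∀ᶠ u in 𝓝 u₀, FlowsIn O Y (g u).1 (g u).2 (Φ (g u)) :=
    hgc.continuousAt.eventually (by rw [hg0]; exact hflow)
  obtain ⟨W', hsub, hopen, hmem⟩ := mem_nhds_iff.1 ((((hc.eventually (by simp)).and
    (hcd.eventually (ContinuousLinearMap.eventually_injective hinj))).and hT).and (hW.and hfl))
  refine ⟨W', fun u => Φ (g u), hopen, ⟨u₀, hmem⟩, fun u hu => (hsub hu).1.1.1,
    fun u hu => (hsub hu).1.1.2, fun u hu => (hsub hu).1.2, fun u hu => ?_, fun u hu => ?_⟩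
  · obtain ⟨γ, a, b, -, hb, hγ, -, h2⟩ := (hsub hu).2.2
    rw [← h2]
    exact (hγ _ hb).1
  · exact (h.flows (ini u) (hsub hu).2.1).snoc (hsub hu).2.2

theorem exists_isFlowImmersion {O : Set E} (hO : IsOpen O) {T : ℝ} (hT : 0 < T) {p : E} (hp : p ∈ O)
    {ι : Type*} (V : ι → E → E) (hV : ∀ i, ContDiffOn ℝ 2 (V i) O) {m : ℕ}
    (htrans : ∀ k < m, ∀ (W : Set (Fin k → ℝ)) (φ : (Fin k → ℝ) → E), IsOpen W → W.Nonempty →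
      (∀ t ∈ W, ContDiffAt ℝ 2 φ t) → (∀ t ∈ W, Function.Injective (fderiv ℝ φ t)) →
      (∀ t ∈ W, φ t ∈ O) → ∃ t ∈ W, ∃ i, V i (φ t) ∉ range (fderiv ℝ φ t)) :
    ∀ k ≤ m, ∃ (j : Fin k → ι) (W : Set (Fin k → ℝ)) (φ : (Fin k → ℝ) → E),
      IsFlowImmersion O T p (fun i => V (j i)) W φ := by
  intro k
  induction k with
  | zero => exact fun _ => ⟨fun i => i.elim0, univ, _, isFlowImmersion_zero hT hp _⟩
  | succ k ih =>
    intro hk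
    obtain ⟨j, W, φ, h⟩ := ih (by omega)
    obtain ⟨t, ht, i, hi⟩ := htrans k (by omega) W φ h.isOpen h.nonempty h.contDiffAt h.injective
      h.mem
    obtain ⟨W', ψ, h'⟩ := h.exists_snoc hO (hV i) ht hi
    refine ⟨(Fin.snoc j i : Fin (k + 1) → ι), W', ψ, ?_⟩
    convert h' using 1
    funext l
    refine Fin.lastCases ?_ (fun l => ?_) l <;> simp

end Concatenation

/-! ### Vector fields in a chart -/

section Chart

variable {m : ℕ} {M : Type*} [TopologicalSpace M] [ChartedSpace (EuclideanSpace ℝ (Fin m)) M]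

/-- The expression of a vector field in the chart at `o`. -/
noncomputable def chartField (o : M) (X : (x : M) → TangentSpace (𝓡 m) x) :
    EuclideanSpace ℝ (Fin m) → EuclideanSpace ℝ (Fin m) :=
  VectorField.mpullback 𝓘(ℝ, EuclideanSpace ℝ (Fin m)) (𝓡 m) (extChartAt (𝓡 m) o).symm X

variable [IsManifold (𝓡 m) ∞ M]

theorem contMDiffAt_extChartAt_symm_of_mem {o : M} {y : EuclideanSpace ℝ (Fin m)}
    (hy : y ∈ (extChartAt (𝓡 m) o).target) :
    ContMDiffAt 𝓘(ℝ, EuclideanSpace ℝ (Fin m)) (𝓡 m) ∞ (extChartAt (𝓡 m) o).symm y :=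
  (contMDiffOn_extChartAt_symm o).contMDiffAt ((isOpen_extChartAt_target o).mem_nhds hy)

theorem isInvertible_mfderiv_extChartAt_symm {o : M} {y : EuclideanSpace ℝ (Fin m)}
    (hy : y ∈ (extChartAt (𝓡 m) o).target) :
    (mfderiv 𝓘(ℝ, EuclideanSpace ℝ (Fin m)) (𝓡 m) (extChartAt (𝓡 m) o).symm y).IsInvertible := by
  have : IsManifold (𝓡 m) 1 M := IsManifold.of_le (n := ∞) (by simp)
  have h := isInvertible_mfderivWithin_extChartAt_symm (I := 𝓡 m) hy
  rwa [ModelWithCorners.range_eq_univ, mfderivWithin_univ] at h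

theorem contDiffAt_chartField {o : M} {X : (x : M) → TangentSpace (𝓡 m) x}
    (hX : IsSmoothVectorField X) {y : EuclideanSpace ℝ (Fin m)}
    (hy : y ∈ (extChartAt (𝓡 m) o).target) : ContDiffAt ℝ 2 (chartField o X) y := by
  have : IsManifold (𝓡 m) 1 M := IsManifold.of_le (n := ∞) (by simp)
  have h := ContMDiffAt.mpullback_vectorField_preimage (n := ∞) (m := 2)
    ((hX _).of_le (by norm_cast)) (contMDiffAt_extChartAt_symm_of_mem hy)
    (isInvertible_mfderiv_extChartAt_symm hy) (by norm_cast)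
  exact contMDiffAt_vectorSpace_iff_contDiffAt.1 h

theorem mlieBracket_eq_lieBracket {E : Type*} [NormedAddCommGroup E] [NormedSpace ℝ E]
    {V W : (x : E) → TangentSpace 𝓘(ℝ, E) x} :
    VectorField.mlieBracket 𝓘(ℝ, E) V W = VectorField.lieBracket ℝ V W := by
  ext y
  rw [← VectorField.mlieBracketWithin_univ, VectorField.mlieBracketWithin_eq_lieBracketWithin]
  exact congrFun (VectorField.lieBracketWithin_univ (𝕜 := ℝ) (V := V) (W := W)) y

theorem chartField_mlieBracket {o : M} {X Y : (x : M) → TangentSpace (𝓡 m) x}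
    (hX : IsSmoothVectorField X) (hY : IsSmoothVectorField Y) {y : EuclideanSpace ℝ (Fin m)}
    (hy : y ∈ (extChartAt (𝓡 m) o).target) :
    chartField o (VectorField.mlieBracket (𝓡 m) X Y) y =
      VectorField.lieBracket ℝ (chartField o X) (chartField o Y) y := by
  have : IsManifold (𝓡 m) (minSmoothness ℝ 2) M := IsManifold.of_le (n := ∞) (by
    rw [minSmoothness_of_isRCLikeNormedField]; norm_cast)
  have h := VectorField.mpullback_mlieBracket (n := ∞)
    ((hX _).mdifferentiableAt (by simp)) ((hY _).mdifferentiableAt (by simp))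
    (contMDiffAt_extChartAt_symm_of_mem hy) (by
      rw [minSmoothness_of_isRCLikeNormedField]; norm_cast)
  exact h.trans (congrFun mlieBracket_eq_lieBracket y)

/-- A bracket costs one derivative, so `C^∞` is the regularity that survives arbitrary nesting. -/
theorem isSmoothVectorField_of_inLieAlgebra {F : Set ((x : M) → TangentSpace (𝓡 m) x)}
    (hF : ∀ X ∈ F, IsSmoothVectorField X) {X : (x : M) → TangentSpace (𝓡 m) x}
    (hX : InLieAlgebraGeneratedBy F X) : IsSmoothVectorField X := by
  induction hX with
  | of X hX => exact hF X hX
  | zero => exact Bundle.contMDiff_zeroSection ℝ (TangentSpace (𝓡 m) : M → Type _)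
  | add X Y _ _ hX hY => exact ContMDiff.add_section hX hY
  | smul c X _ hX => exact ContMDiff.const_smul_section hX
  | bracket X Y _ _ hX hY =>
    have : IsManifold (𝓡 m) (((⊤ : ℕ∞) : ℕ∞ω) + 1) M := by simpa
    have : IsManifold (𝓡 m) (minSmoothness ℝ 2) M := IsManifold.of_le (n := ∞) (by
      rw [minSmoothness_of_isRCLikeNormedField]; norm_cast)
    intro x
    exact ContMDiffAt.mlieBracket_vectorField (m := ⊤) (n := ⊤) (hX x) (hY x) (by
      rw [minSmoothness_of_isRCLikeNormedField]; simp)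

/-- Tangency is carried on the whole open set `W`: the bracket step needs it in a neighbourhood of
each parameter. -/
theorem chartField_mem_range_of_inLieAlgebra {F : Set ((x : M) → TangentSpace (𝓡 m) x)}
    (hF : ∀ X ∈ F, IsSmoothVectorField X) {o : M} {k : ℕ} {W : Set (Fin k → ℝ)}
    {φ : (Fin k → ℝ) → EuclideanSpace ℝ (Fin m)} (hW : IsOpen W)
    (hφ : ∀ t ∈ W, ContDiffAt ℝ 2 φ t) (hinj : ∀ t ∈ W, Function.Injective (fderiv ℝ φ t))
    (hmem : ∀ t ∈ W, φ t ∈ (extChartAt (𝓡 m) o).target)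
    (htan : ∀ X ∈ F, ∀ t ∈ W, chartField o X (φ t) ∈ range (fderiv ℝ φ t))
    {X : (x : M) → TangentSpace (𝓡 m) x} (hX : InLieAlgebraGeneratedBy F X) :
    ∀ t ∈ W, chartField o X (φ t) ∈ range (fderiv ℝ φ t) := by
  induction hX with
  | of X hX => exact htan X hX
  | zero =>
    refine fun t _ => ⟨0, ?_⟩
    rw [map_zero]
    exact (map_zero (mfderiv 𝓘(ℝ, EuclideanSpace ℝ (Fin m)) (𝓡 m) (extChartAt (𝓡 m) o).symm
      (φ t)).inverse).symm
  | add X Y _ _ hX hY =>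
    intro t ht
    obtain ⟨a, ha⟩ := hX t ht
    obtain ⟨b, hb⟩ := hY t ht
    refine ⟨a + b, ?_⟩
    rw [map_add, ha, hb]
    exact (map_add (mfderiv 𝓘(ℝ, EuclideanSpace ℝ (Fin m)) (𝓡 m) (extChartAt (𝓡 m) o).symm
      (φ t)).inverse _ _).symm
  | smul c X _ hX =>
    intro t ht
    obtain ⟨a, ha⟩ := hX t ht
    refine ⟨c • a, ?_⟩
    rw [map_smul, ha]
    exact (map_smul (mfderiv 𝓘(ℝ, EuclideanSpace ℝ (Fin m)) (𝓡 m) (extChartAt (𝓡 m) o).symm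
      (φ t)).inverse _ _).symm
  | bracket X Y hX' hY' hX hY =>
    intro t ht
    have hXs := isSmoothVectorField_of_inLieAlgebra hF hX'
    have hYs := isSmoothVectorField_of_inLieAlgebra hF hY'
    rw [chartField_mlieBracket hXs hYs (hmem t ht)]
    exact lieBracket_mem_range_fderiv (hφ t ht) (hinj t ht)
      ((contDiffAt_chartField hXs (hmem t ht)).differentiableAt (by norm_num))
      ((contDiffAt_chartField hYs (hmem t ht)).differentiableAt (by norm_num))
      (Filter.eventually_of_mem (hW.mem_nhds ht) hX) (Filter.eventually_of_mem (hW.mem_nhds ht) hY)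

/-- Otherwise the generated Lie algebra, which fills the tangent space, would be tangent to `φ`, and
a linear map from `ℝ^k` would be onto `ℝ^m`. -/
theorem exists_transversal {F : Set ((x : M) → TangentSpace (𝓡 m) x)}
    (hF : ∀ X ∈ F, IsSmoothVectorField X) (hgen : IsBracketGenerating F) {o : M} {k : ℕ}
    (hk : k < m) {W : Set (Fin k → ℝ)}
    {φ : (Fin k → ℝ) → EuclideanSpace ℝ (Fin m)} (hW : IsOpen W) (hne : W.Nonempty)
    (hφ : ∀ t ∈ W, ContDiffAt ℝ 2 φ t) (hinj : ∀ t ∈ W, Function.Injective (fderiv ℝ φ t))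
    (hmem : ∀ t ∈ W, φ t ∈ (extChartAt (𝓡 m) o).target) :
    ∃ t ∈ W, ∃ X : F, chartField o X.1 (φ t) ∉ range (fderiv ℝ φ t) := by
  by_contra! hcon
  obtain ⟨t, ht⟩ := hne
  have hsurj : Function.Surjective (fderiv ℝ φ t) := by
    intro w
    obtain ⟨X, hX, hXw⟩ := hgen ((extChartAt (𝓡 m) o).symm (φ t))
      (mfderiv 𝓘(ℝ, EuclideanSpace ℝ (Fin m)) (𝓡 m) (extChartAt (𝓡 m) o).symm (φ t) w)
    have h := chartField_mem_range_of_inLieAlgebra hF hW hφ hinj hmem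
      (fun X hX t ht => hcon t ht ⟨X, hX⟩) hX t ht
    have hw : chartField o X (φ t) = w := by
      rw [chartField, VectorField.mpullback_apply, hXw]
      obtain ⟨A, hA⟩ := isInvertible_mfderiv_extChartAt_symm (hmem t ht)
      rw [← hA, ContinuousLinearMap.inverse_equiv]
      exact A.symm_apply_apply w
    rwa [hw] at h
  have := LinearMap.finrank_le_finrank_of_surjective 
    (f := (fderiv ℝ φ t : (Fin k → ℝ) →ₗ[ℝ] EuclideanSpace ℝ (Fin m))) hsurj
  simp at this
  omega

theorem FlowsIn.flowsTo {o : M} {X : (x : M) → TangentSpace (𝓡 m) x} {t : ℝ}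
    {p q : EuclideanSpace ℝ (Fin m)}
    (h : FlowsIn (extChartAt (𝓡 m) o).target (chartField o X) t p q) :
    FlowsTo X t ((extChartAt (𝓡 m) o).symm p) ((extChartAt (𝓡 m) o).symm q) := by
  obtain ⟨γ, a, b, h0, ht, hγ, hp, hq⟩ := h
  refine ⟨(extChartAt (𝓡 m) o).symm ∘ γ, a, b, h0, ht, fun s hs => ?_, congrArg _ hp,
    congrArg _ hq⟩
  obtain ⟨hmem, hd⟩ := hγ s hs
  have h1 := ((contMDiffAt_extChartAt_symm_of_mem hmem).mdifferentiableAt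
    (by simp)).hasMFDerivAt.comp s hd.hasFDerivAt.hasMFDerivAt
  refine (h1.congr_mfderiv ?_).hasMFDerivWithinAt
  obtain ⟨A, hA⟩ := isInvertible_mfderiv_extChartAt_symm hmem
  have hX : chartField o X (γ s) = A.symm (X ((extChartAt (𝓡 m) o).symm (γ s))) := by
    rw [chartField, VectorField.mpullback_apply, ← hA, ContinuousLinearMap.inverse_equiv]
    rfl
  ext1
  rw [hX, ← hA]
  change A ((1 : ℝ) • A.symm _) = (1 : ℝ) • _
  rw [one_smul, one_smul]
  exact A.apply_symm_apply _

theorem ChainFlowsIn.concatenationFlowsTo {o : M} {k : ℕ}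
    {X : Fin k → (x : M) → TangentSpace (𝓡 m) x} {t : Fin k → ℝ} {p q : EuclideanSpace ℝ (Fin m)}
    (h : ChainFlowsIn (extChartAt (𝓡 m) o).target (fun i => chartField o (X i)) t p q) :
    ConcatenationFlowsTo X t ((extChartAt (𝓡 m) o).symm p) ((extChartAt (𝓡 m) o).symm q) := by
  obtain ⟨c, h0, hl, h⟩ := h
  exact ⟨fun i => (extChartAt (𝓡 m) o).symm (c i), congrArg _ h0, congrArg _ hl,
    fun i => (h i).flowsTo⟩

end Chart

theorem proposition2p8 (m : ℕ) (hm : 1 ≤ m) {M : Type*} [TopologicalSpace M] [T2Space M]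
    [ChartedSpace (EuclideanSpace ℝ (Fin m)) M] [IsManifold (𝓡 m) ∞ M]
    (F : Set ((x : M) → TangentSpace (𝓡 m) x))
    (hsmooth : ∀ X ∈ F, IsSmoothVectorField X)
    (hF : IsBracketGenerating F) :
    EssentiallyNonHolonomic F := by
  obtain ⟨n, rfl⟩ : ∃ n, m = n + 1 := ⟨m - 1, by omega⟩
  intro T hT o
  obtain ⟨X, W, φ, h⟩ := exists_isFlowImmersion (isOpen_extChartAt_target (I := 𝓡 (n + 1)) o) hT
    (mem_extChartAt_target o) (fun X : F => chartField o X.1)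
    (fun X y hy => (contDiffAt_chartField (hsmooth _ X.2) hy).contDiffWithinAt)
    (fun k hk W φ hW hne hφ hinj hmem => exists_transversal hsmooth hF hk hW hne hφ hinj hmem)
    (n + 1) le_rfl
  obtain ⟨t₀, ht₀⟩ := h.nonempty
  let L : EuclideanSpace ℝ (Fin (n + 1)) ≃L[ℝ] (Fin (n + 1) → ℝ) := EuclideanSpace.equiv _ ℝ
  let ψ : EuclideanSpace ℝ (Fin (n + 1)) → EuclideanSpace ℝ (Fin (n + 1)) := fun t => φ (L t)
  have hψ : ∀ t, L t ∈ W → ContDiffAt ℝ 2 ψ t := fun t ht =>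
    (h.contDiffAt _ ht).comp t L.contDiff.contDiffAt
  let D : EuclideanSpace ℝ (Fin (n + 1)) →L[ℝ] EuclideanSpace ℝ (Fin (n + 1)) :=
    (fderiv ℝ φ t₀).comp (L : EuclideanSpace ℝ (Fin (n + 1)) →L[ℝ] (Fin (n + 1) → ℝ))
  have hψd : HasFDerivAt ψ D (L.symm t₀) := by
    refine HasFDerivAt.comp _ ?_ L.hasFDerivAt
    rw [L.apply_symm_apply]
    exact ((h.contDiffAt _ ht₀).differentiableAt (by norm_num)).hasFDerivAt
  have hinj : Function.Injective D.toLinearMap :=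
    fun _ _ hxy => L.injective (h.injective _ ht₀ hxy)
  let A : EuclideanSpace ℝ (Fin (n + 1)) ≃L[ℝ] EuclideanSpace ℝ (Fin (n + 1)) :=
    (LinearEquiv.ofInjectiveEndo _ hinj).toContinuousLinearEquiv
  have hA : HasFDerivAt ψ (A : _ →L[ℝ] _) (L.symm t₀) := by
    refine hψd.congr_fderiv ?_
    ext x : 1
    rfl
  have hc : ContDiffAt ℝ 2 ψ (L.symm t₀) := hψ _ (by rwa [L.apply_symm_apply])
  -- The local inverse of `ψ` followed by the inverse chart is only needed near the base time; `f`
  -- is defined on the whole of `L ⁻¹' W` and agrees with `e` on its source.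
  let e := (hc.toOpenPartialHomeomorph ψ hA (by norm_num)).trans
    (chartAt (EuclideanSpace ℝ (Fin (n + 1))) o).symm
  have hΩ : IsOpen (L ⁻¹' W) := h.isOpen.preimage L.continuous
  have hmem : L.symm t₀ ∈ L ⁻¹' W := by rwa [mem_preimage, L.apply_symm_apply]
  let f : C(L ⁻¹' W, M) := ⟨fun t => (extChartAt (𝓡 (n + 1)) o).symm (ψ t), by
    refine (continuousOn_extChartAt_symm o).comp_continuous ?_ fun t => h.mem _ t.2
    exact continuous_iff_continuousAt.2 fun t =>
      (hψ t.1 t.2).continuousAt.comp continuous_subtype_val.continuousAt⟩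
  obtain ⟨U, hU⟩ := essentiallyOpenAt_of_openPartialHomeomorph e hΩ f (fun x _ => by
    simp [f, e, mfld_simps]) ⟨L.symm t₀, hmem⟩ (by
      have hy : ψ (L.symm t₀) ∈ (chartAt (EuclideanSpace ℝ (Fin (n + 1))) o).target := by
        have := h.mem _ ht₀
        simp only [ψ, L.apply_symm_apply]
        simpa [mfld_simps] using this
      refine ⟨hc.mem_toOpenPartialHomeomorph_source hA (by norm_num), ?_⟩
      simpa using hy)
  refine ⟨fun i => (X i).1, L.symm t₀, fun i => (X i).2, h.time_lt _ ht₀, L ⁻¹' W, hmem, f, U, hΩ,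
    fun t ht => h.time_lt _ ht, fun t => ?_, hU⟩
  have := (h.flows _ t.2).concatenationFlowsTo
  rwa [extChartAt_to_inv] at this
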